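/- Let $p$ be even and let $\pm[p/2]=\{-p/2,\dots,-1,1,\dots,p/2\}$ index the coordinates of $\mathbb{R}^p$. An angle $g\in[0,2\pi)$ acts on $\theta\in\mathbb{R}^p$ by rotating each pair $(\theta_j,\theta_{-j})$, $j>0$, by the angle $jg$. For $j>0$ put $\hat\theta_{j}=\frac{1}{\sqrt2}(\theta_j+\mathrm{i}\,\theta_{-j})$ and $\hat\theta_{-j}=\frac{1}{\sqrt2}(\theta_j-\mathrm{i}\,\theta_{-j})$; let $\Delta$ be the unitary matrix with $\theta=\Delta\hat\theta$, and for a tensor $X\in(\mathbb{R}^p)^{\otimes d}$ let $\hat X$ be the tensor with $X=\Delta^{\otimes d}\hat X$. Let $\theta^1,\dots,\theta^K$ be independent with law $\mathcal N(0,I_p/p)$, and let $$T^k=\mathbb{E}_g\big[(g\cdot\theta^k)^{\otimes 3}\big],\qquad \Theta^k=(\theta^k\otimes\theta^k)(\theta^k\otimes\theta^k)^\top,$$ with $g$ uniform on $[0,2\pi)$. For $a,b,c,d\in\pm[p/2]$ and $\theta\sim\mathcal N(0,I_p/p)$ let $$s_{abcd}=\sum_{i_1,\dots,i_9}\sum_{j_1,\dots,j_5}\mathbf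 1[\mathcal Z]\;|\hat\theta_{i_1}|^2\cdots|\hat\theta_{i_9}|^2\,|\hat\theta_{j_1}|^2\cdots|\hat\theta_{j_5}|^2,$$ all indices ranging over $\pm[p/2]$, where $\mathcal Z$ is the system of nine equations $-i_1+a+i_2=0$, $-i_2+j_1+i_3=0$, $-i_3+c+i_4=0$, $-i_4+j_2+i_5=0$, $-i_5+b+i_6=0$, $-i_6+j_3+i_7=0$, $-i_7+d+i_8=0$, $-i_8+j_4+i_9=0$, $-i_9+j_5+i_1=0$. Put $S_{abcd}=0$ if $a=-b$ or $c=-d$, and $S_{abcd}=1/\mathbb{E}[s_{abcd}]$ otherwise. For $T\in(\mathbb{R}^p)^{\otimes3}$ and $u\in(\mathbb{R}^p)^{\otimes5}$ let $M(T,u)=(\Delta\otimes\Delta)\,\hat M(T,u)\,(\Delta\otimes\Delta)^\top$, where $\hat M(T,u)$ is the $p^2\times p^2$ matrix with entries $$\hat M(T,u)_{ab,cd}=S_{abcd}\sum_{i_1,\dots,i_9}\sum_{j_1,\dots,j_5}\hat u_{-j_1,-j_2,-j_3,-j_4,-j_5}\,\hat T_{-i_1,a,i_2}\hat T_{-i_2,j_1,i_3}\hat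 T_{-i_3,c,i_4}\hat T_{-i_4,j_2,i_5}\hat T_{-i_5,b,i_6}\hat T_{-i_6,j_3,i_7}\hat T_{-i_7,d,i_8}\hat T_{-i_8,j_4,i_9}\hat T_{-i_9,j_5,i_1}.$$ Then the following hold. 1. $\mathbb{E}[s_{abcd}]=\Theta(p^{-9})$ uniformly: there are constants $c_1,c_2>0$ such that for all sufficiently large even $p$ and all $a,b,c,d\in\pm[p/2]$, $c_1p^{-9}\le\mathbb{E}[s_{abcd}]\le c_2p^{-9}$. 2. There are a sequence $\eta(p)\to0$ and a sequence $\varepsilon(p)$ with $p^{m}\varepsilon(p)\to0$ for every $m\in\mathbb{N}$ such that for all even $p$, all $K$ and all $k\in\{1,\dots,K\}$, with probability at least $1-\varepsilon(p)$, $$\big\|M\big(T^k,(\theta^k)^{\otimes5}\big)-\Theta^k\big\|\le\eta(p),$$ where $\|\cdot\|$ is the spectral norm. -/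

import Mathlib

open MeasureTheory ProbabilityTheory Filter Topology
open scoped Matrix Kronecker ComplexConjugate

noncomputable section

namespace ContinuousMRA

/-- The frequency set `±[p/2] = {-p/2, …, -1, 1, …, p/2}` (used for even `p`). -/
def Freq (p : ℕ) : Type :=
  {j : ℤ // j ∈ (Finset.Icc (-((p / 2 : ℕ) : ℤ)) ((p / 2 : ℕ) : ℤ)).erase 0}

instance (p : ℕ) : Fintype (Freq p) :=
  inferInstanceAs (Fintype
    {j : ℤ // j ∈ (Finset.Icc (-((p / 2 : ℕ) : ℤ)) ((p / 2 : ℕ) : ℤ)).erase 0})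

instance (p : ℕ) : DecidableEq (Freq p) :=
  inferInstanceAs (DecidableEq
    {j : ℤ // j ∈ (Finset.Icc (-((p / 2 : ℕ) : ℤ)) ((p / 2 : ℕ) : ℤ)).erase 0})

/-- The integer value of a frequency. -/
def Freq.toInt {p : ℕ} (j : Freq p) : ℤ := j.1

instance (p : ℕ) : Neg (Freq p) where
  neg j := ⟨-j.1, by
    have h := j.2
    simp only [Finset.mem_erase, Finset.mem_Icc, ne_eq] at h ⊢
    omega⟩

/-- The law `N(0, I_p / p)`: independent centred Gaussian coordinates of variance `1/p`. -/
def signalLaw (p : ℕ) : Measure (Freq p → ℝ) :=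
  Measure.pi fun _ => gaussianReal 0 (1 / (p : NNReal))

/-- Action of the rotation by angle `g` on `ℝ^p`. For `j > 0` it acts on `(θ_j, θ_{-j})` by the
matrix `!![cos (j g), -sin (j g); sin (j g), cos (j g)]`; by parity of `cos` and `sin`, both rows
are given by the single formula below. -/
def rotate {p : ℕ} (g : ℝ) (θ : Freq p → ℝ) : Freq p → ℝ := fun j =>
  Real.cos (j.toInt * g) * θ j - Real.sin (j.toInt * g) * θ (-j)

/-- The Fourier coefficients: `θ̂_j = (θ_j + i θ_{-j}) / √2` and `θ̂_{-j} = (θ_j - i θ_{-j}) / √2`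
for `j > 0`. -/
def fourier {p : ℕ} (θ : Freq p → ℝ) : Freq p → ℂ := fun j =>
  if 0 < j.toInt then (θ j + Complex.I * θ (-j)) / (Real.sqrt 2 : ℂ)
  else (θ (-j) - Complex.I * θ j) / (Real.sqrt 2 : ℂ)

/-- The unitary matrix `Δ` converting Fourier coordinates to standard ones, `θ = Δ θ̂`: for `j > 0`,
`θ_j = (θ̂_j + θ̂_{-j}) / √2` and `θ_{-j} = -i (θ̂_j - θ̂_{-j}) / √2`. -/
def Delta (p : ℕ) : Matrix (Freq p) (Freq p) ℂ := Matrix.of fun r c =>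
  if 0 < r.toInt then
    ((if c = r then 1 else 0) + (if c = -r then 1 else 0)) / (Real.sqrt 2 : ℂ)
  else
    -Complex.I * ((if c = -r then 1 else 0) - (if c = r then 1 else 0)) / (Real.sqrt 2 : ℂ)

/-- Tensors of order `d` over `R`, with every index running over `±[p/2]`. -/
abbrev Tensor (R : Type) (p d : ℕ) : Type := (Fin d → Freq p) → R

/-- The `d`-th tensor power of a vector. -/
def tensorPow {p : ℕ} (d : ℕ) (θ : Freq p → ℝ) : Tensor ℝ p d := fun x => ∏ l, θ (x l)

/-- The Fourier transform `T̂` of a tensor, determined by `T = Δ^{⊗d} T̂`; that is,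
`T̂ = (Δᴴ)^{⊗d} T`. -/
def tensorFourier {p d : ℕ} (T : Tensor ℝ p d) : Tensor ℂ p d := fun x =>
  ∑ y : Fin d → Freq p, (∏ l, (Delta p)ᴴ (x l) (y l)) * (T y : ℂ)

/-- `E_g[(g · θ)^{⊗3}]` for `g` uniform on `[0, 2π)`. -/
def thirdMoment {p : ℕ} (θ : Freq p → ℝ) : Tensor ℝ p 3 := fun x =>
  (2 * Real.pi)⁻¹ * ∫ g in (0 : ℝ)..(2 * Real.pi), tensorPow 3 (rotate g θ) x

/-- The zero-sum constraints at the nine vertices of the tensor network. -/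
def ZeroSum {p : ℕ} (a b c d : Freq p) (i : Fin 9 → Freq p) (j : Fin 5 → Freq p) : Prop :=
  -(i 0).toInt + a.toInt + (i 1).toInt = 0 ∧
  -(i 1).toInt + (j 0).toInt + (i 2).toInt = 0 ∧
  -(i 2).toInt + c.toInt + (i 3).toInt = 0 ∧
  -(i 3).toInt + (j 1).toInt + (i 4).toInt = 0 ∧
  -(i 4).toInt + b.toInt + (i 5).toInt = 0 ∧
  -(i 5).toInt + (j 2).toInt + (i 6).toInt = 0 ∧
  -(i 6).toInt + d.toInt + (i 7).toInt = 0 ∧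
  -(i 7).toInt + (j 3).toInt + (i 8).toInt = 0 ∧
  -(i 8).toInt + (j 4).toInt + (i 0).toInt = 0

open Classical in
/-- The random variable `s_{abcd}`, as a function of the signal. -/
def sCoeff {p : ℕ} (θ : Freq p → ℝ) (a b c d : Freq p) : ℝ :=
  ∑ i : Fin 9 → Freq p, ∑ j : Fin 5 → Freq p,
    (if ZeroSum a b c d i j then 1 else 0) *
      ((∏ l, ‖fourier θ (i l)‖ ^ 2) * ∏ l, ‖fourier θ (j l)‖ ^ 2)

/-- The expectation `E[s_{abcd}]` under `θ ∼ N(0, I_p / p)`. -/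
def meanS {p : ℕ} (a b c d : Freq p) : ℝ := ∫ θ, sCoeff θ a b c d ∂(signalLaw p)

/-- The correction factors `S_{abcd}`. -/
def correction {p : ℕ} (a b c d : Freq p) : ℝ :=
  if a = -b ∨ c = -d then 0 else 1 / meanS a b c d

/-- The Fourier-domain matrix `M̂(T, u)`: the entrywise correction applied to the
`({a,b},{c,d})`-flattening of the nine-vertex ring network. Here `i_1, …, i_9` are `i 0, …, i 8`
and `j_1, …, j_5` are `j 0, …, j 4`. -/
def networkHat {p : ℕ} (T : Tensor ℝ p 3) (u : Tensor ℝ p 5) :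
    Matrix (Freq p × Freq p) (Freq p × Freq p) ℂ := Matrix.of fun ab cd =>
  (correction ab.1 ab.2 cd.1 cd.2 : ℂ) *
    ∑ i : Fin 9 → Freq p, ∑ j : Fin 5 → Freq p,
      tensorFourier u ![-j 0, -j 1, -j 2, -j 3, -j 4] *
      tensorFourier T ![-i 0, ab.1, i 1] *
      tensorFourier T ![-i 1, j 0, i 2] *
      tensorFourier T ![-i 2, cd.1, i 3] *
      tensorFourier T ![-i 3, j 1, i 4] *
      tensorFourier T ![-i 4, ab.2, i 5] *
      tensorFourier T ![-i 5, j 2, i 6] *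
      tensorFourier T ![-i 6, cd.2, i 7] *
      tensorFourier T ![-i 7, j 3, i 8] *
      tensorFourier T ![-i 8, j 4, i 0]

/-- The corrected network matrix `M(T, u) = (Δ ⊗ Δ) M̂(T, u) (Δ ⊗ Δ)ᵀ`. Its entries are real numbers,
written here as complex numbers. -/
def networkMatrix {p : ℕ} (T : Tensor ℝ p 3) (u : Tensor ℝ p 5) :
    Matrix (Freq p × Freq p) (Freq p × Freq p) ℂ :=
  (Delta p ⊗ₖ Delta p) * networkHat T u * (Delta p ⊗ₖ Delta p)ᵀ

/-- The target matrix `Θ = (θ ⊗ θ)(θ ⊗ θ)ᵀ`. -/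
def targetMatrix {p : ℕ} (θ : Freq p → ℝ) : Matrix (Freq p × Freq p) (Freq p × Freq p) ℝ :=
  Matrix.vecMulVec (fun ab => θ ab.1 * θ ab.2) (fun cd => θ cd.1 * θ cd.2)

/-- The spectral norm of a square matrix: its operator norm on Euclidean space (on real matrices it
agrees with the operator norm on real Euclidean space). -/
def matrixSpectralNorm {n : Type} [Fintype n] [DecidableEq n] (A : Matrix n n ℂ) : ℝ :=
  ‖Matrix.toEuclideanCLM (n := n) (𝕜 := ℂ) A‖

theorem Freq.toInt_ne_zero {p : ℕ} (j : Freq p) : j.toInt ≠ 0 :=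
  (Finset.mem_erase.1 j.2).1

theorem Freq.toInt_neg {p : ℕ} (j : Freq p) : (-j).toInt = -j.toInt := rfl

theorem Freq.toInt_injective {p : ℕ} : Function.Injective (Freq.toInt (p := p)) :=
  Subtype.val_injective

theorem Freq.neg_neg {p : ℕ} (j : Freq p) : - -j = j :=
  Freq.toInt_injective (by simp [Freq.toInt_neg])

theorem Freq.ne_neg {p : ℕ} (j : Freq p) : j ≠ -j := fun h => by
  have := congrArg Freq.toInt h
  have h0 := j.toInt_ne_zero
  rw [Freq.toInt_neg] at this
  omega

/-- `θ = Δ θ̂`. -/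
theorem Delta_mulVec_fourier {p : ℕ} (θ : Freq p → ℝ) :
    Delta p *ᵥ fourier θ = fun j => (θ j : ℂ) := by
  have h2 : (Real.sqrt 2 : ℂ) * (Real.sqrt 2 : ℂ) = 2 := by
    rw [← Complex.ofReal_mul, Real.mul_self_sqrt (by norm_num)]; norm_num
  have hne : (Real.sqrt 2 : ℂ) ≠ 0 := fun h => by simp [h] at h2
  funext r
  have key : ∀ (x y : ℂ), (∑ c : Freq p, (x * (if c = r then 1 else 0) +
      y * (if c = -r then 1 else 0)) * fourier θ c) = x * fourier θ r + y * fourier θ (-r) := by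
    intro x y
    simp [add_mul, Finset.sum_add_distrib]
  by_cases hr : 0 < r.toInt
  · have := key (1 / (Real.sqrt 2 : ℂ)) (1 / (Real.sqrt 2 : ℂ))
    have hr' : ¬ 0 < (-r).toInt := by rw [Freq.toInt_neg]; omega
    calc _ = _ := by
          simp only [Matrix.mulVec, dotProduct, Delta, Matrix.of_apply, if_pos hr]
          refine Eq.trans (Finset.sum_congr rfl fun c _ => ?_) this
          ring
      _ = _ := by
          simp only [fourier, if_pos hr, if_neg hr', Freq.neg_neg]
          field_simp
          linear_combination (-(θ r : ℂ)) * h2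
  · have := key (Complex.I / (Real.sqrt 2 : ℂ)) (-Complex.I / (Real.sqrt 2 : ℂ))
    have hr' : 0 < (-r).toInt := by
      have := r.toInt_ne_zero
      rw [Freq.toInt_neg]; omega
    calc _ = _ := by
          simp only [Matrix.mulVec, dotProduct, Delta, Matrix.of_apply, if_neg hr]
          refine Eq.trans (Finset.sum_congr rfl fun c _ => ?_) this
          ring
      _ = _ := by
          simp only [fourier, if_pos hr', if_neg hr, Freq.neg_neg]
          field_simp
          ring_nf
          linear_combination (-(θ r : ℂ)) * h2 - 2 * (θ r : ℂ) * Complex.I_sq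

/-- `Δ` is unitary. -/
theorem Delta_mul_conjTranspose (p : ℕ) : Delta p * (Delta p)ᴴ = 1 := by
  have h2 : (Real.sqrt 2 : ℂ) * (Real.sqrt 2 : ℂ) = 2 := by
    rw [← Complex.ofReal_mul, Real.mul_self_sqrt (by norm_num)]; norm_num
  have hne : (Real.sqrt 2 : ℂ) ≠ 0 := fun h => by simp [h] at h2
  have key : ∀ (r : Freq p) (x y : ℂ) (f : Freq p → ℂ),
      (∑ c : Freq p, (x * (if c = r then 1 else 0) +
        y * (if c = -r then 1 else 0)) * f c) = x * f r + y * f (-r) := by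
    intro r x y f
    simp [add_mul, Finset.sum_add_distrib]
  have hform : ∀ r : Freq p, ∃ x y : ℂ, x * conj x + y * conj y = 1 ∧
      (∀ c, Delta p r c = x * (if c = r then 1 else 0) + y * (if c = -r then 1 else 0)) ∧
      (if 0 < r.toInt then x = 1 / (Real.sqrt 2 : ℂ) ∧ y = 1 / (Real.sqrt 2 : ℂ)
        else x = Complex.I / (Real.sqrt 2 : ℂ) ∧ y = -Complex.I / (Real.sqrt 2 : ℂ)) := by
    intro r
    by_cases hr : 0 < r.toInt
    · refine ⟨1 / (Real.sqrt 2 : ℂ), 1 / (Real.sqrt 2 : ℂ), ?_, ?_, by simp [hr]⟩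
      · simp only [map_div₀, map_one, Complex.conj_ofReal]
        field_simp
        linear_combination -h2
      · intro c
        simp only [Delta, Matrix.of_apply, if_pos hr]
        ring
    · refine ⟨Complex.I / (Real.sqrt 2 : ℂ), -Complex.I / (Real.sqrt 2 : ℂ), ?_, ?_, by simp [hr]⟩
      · simp only [map_div₀, map_neg, Complex.conj_I, Complex.conj_ofReal]
        field_simp
        linear_combination -2 * Complex.I_sq - h2
      · intro c
        simp only [Delta, Matrix.of_apply, if_neg hr]
        ring
  ext r s
  obtain ⟨x, y, hxy, hD, hv⟩ := hform r
  obtain ⟨x', y', -, hD', hv'⟩ := hform s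
  have hsum : (Delta p * (Delta p)ᴴ) r s = x * conj (Delta p s r) + y * conj (Delta p s (-r)) := by
    rw [Matrix.mul_apply, ← key r x y fun c => conj (Delta p s c)]
    exact Finset.sum_congr rfl fun c _ => by rw [hD, Matrix.conjTranspose_apply]; rfl
  rw [hsum]
  by_cases hrs : r = s
  · subst hrs
    rw [Matrix.one_apply_eq, hD, hD, if_pos rfl, if_pos rfl, if_neg r.ne_neg, if_neg r.ne_neg.symm]
    simpa using hxy
  · rw [Matrix.one_apply_ne hrs, hD', hD', if_neg hrs]
    by_cases hrs' : -r = s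
    · have hrs2 : r = -s := by rw [← hrs', Freq.neg_neg]
      have hs : s.toInt = -r.toInt := by rw [← hrs', Freq.toInt_neg]
      have h0 := r.toInt_ne_zero
      have hns : ¬ s = -s := s.ne_neg
      rw [if_pos hrs2, if_pos hrs', hrs', if_neg hns]
      by_cases hr : 0 < r.toInt
      · have hs' : ¬ 0 < s.toInt := by omega
        rw [if_pos hr] at hv
        rw [if_neg hs'] at hv'
        rw [hv.1, hv.2, hv'.1, hv'.2]
        simp only [map_add, map_mul, map_div₀, map_neg, Complex.conj_I, Complex.conj_ofReal,
          map_zero, map_one]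
        ring
      · have hs' : 0 < s.toInt := by omega
        rw [if_neg hr] at hv
        rw [if_pos hs'] at hv'
        rw [hv.1, hv.2, hv'.1, hv'.2]
        simp only [map_add, map_mul, map_div₀, Complex.conj_ofReal,
          map_zero, map_one]
        ring
    · have h1 : ¬ r = -s := fun h => hrs' (by rw [h, Freq.neg_neg])
      have h3 : ¬ -r = -s := fun h => hrs (by rw [← Freq.neg_neg r, h, Freq.neg_neg])
      rw [if_neg h1, if_neg hrs', if_neg h3]
      simp

end ContinuousMRA

end

open ContinuousMRA

noncomputable section

namespace ContinuousMRA

/-! ### The bounded differences inequality -/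

/-! A rotation by `g` multiplies the `j`-th Fourier coefficient by `exp (i j g)`, so averaging over
`g` keeps exactly the entries of the cubic tensor whose frequencies sum to zero. In the ring network
each internal index occurs once with each sign, hence contributes a squared modulus. The hatted
network entry is therefore exactly the correction times `s_abcd`, times the product of the Fourier
coefficients at `a`, `b`, `c`, `d` (`networkHat_apply`). Since `Δ ⊗ Δ` is unitary, the spectral
error is at most the Frobenius norm of the hatted error (`matrixSpectralNorm_networkMatrix_sub_le`).

Order of the mean: nine independent equations in fourteen frequencies leave of order `p ^ 5`
solutions (`card_zeroSumTuples_le`, `le_card_zeroSumTuples`), and each monomial has expectation of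
order `p ^ (-14)`, whichever indices coincide.

Concentration: with coordinates truncated at `θ_k ^ 2 ≤ x / p`, one coordinate enters at most `28 p
^ 4` monomials, each at most `(x / p) ^ 14`. McDiarmid's inequality then gives fluctuations of about
`p ^ (-9.5)` times a power of `x`, negligible against `p ^ (-9)` when `x = p ^ (1 / 100)`.
Truncation moves the mean negligibly (`meanS_sub_integral_sCoeff_clip_le`), and a union bound covers
all quadruples.

What remains are the entries with `a = -b` or `c = -d`, where the correction is zero. They carry
only a fraction of order `1 / p` of the squared mass, up to powers of `x` (`sqrt_error_le`). -/

theorem hasSubgaussianMGF_of_bounded_difference_fin {μ : Measure ℝ} [IsProbabilityMeasure μ]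
    {c : NNReal} : ∀ {n : ℕ} {f : (Fin n → ℝ) → ℝ} {B : ℝ}, Measurable f → (∀ x, |f x| ≤ B) →
      (∀ x i v, |f (Function.update x i v) - f x| ≤ c) →
      HasSubgaussianMGF (fun x => f x - ∫ y, f y ∂(Measure.pi fun _ => μ)) (n * c ^ 2)
        (Measure.pi fun _ : Fin n => μ)
  | 0, f, B, _, _, _ => by
    have h : ∀ x : Fin 0 → ℝ, f x = f 0 := fun x => by rw [Subsingleton.elim x 0]
    have h2 : (fun x : Fin 0 → ℝ => f x - ∫ y, f y ∂(Measure.pi fun _ => μ)) = fun _ => 0 := by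
      funext x
      rw [integral_congr_ae (ae_of_all _ h), h x]
      simp
    rw [h2]
    simp
  | n + 1, f, B, hf, hB, hc => by
    set ν : Measure (Fin n → ℝ) := Measure.pi fun _ => μ with hν
    set e := MeasurableEquiv.piFinSuccAbove (fun _ : Fin (n + 1) => ℝ) 0 with he
    have hmp : MeasurePreserving e (Measure.pi fun _ => μ) (μ.prod ν) :=
      measurePreserving_piFinSuccAbove (fun _ : Fin (n + 1) => μ) 0
    have hes : ∀ q : ℝ × (Fin n → ℝ), e.symm q = Fin.cons q.1 q.2 := fun q => by
      simp [he, Fin.consEquiv]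
    set g : ℝ × (Fin n → ℝ) → ℝ := fun q => f (e.symm q) with hg
    have hgm : Measurable g := hf.comp e.symm.measurable
    have hgB : ∀ q, |g q| ≤ B := fun q => hB _
    -- Integrating out the first coordinate preserves boundedness and the difference constant, so
    -- the induction hypothesis applies to `F`. The remaining fluctuation `g - F` is centred in `x`
    -- for each fixed `y`.
    set F : (Fin n → ℝ) → ℝ := fun y => ∫ x, g (x, y) ∂μ with hF
    have hgm1 : ∀ y, Measurable fun x => g (x, y) := fun y =>
      hgm.comp (measurable_id.prodMk measurable_const)
    have hgi : ∀ y, Integrable (fun x => g (x, y)) μ := fun y =>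
      Integrable.of_bound (hgm1 y).aestronglyMeasurable B (ae_of_all _ fun x => hgB _)
    have hFm : Measurable F :=
      (StronglyMeasurable.integral_prod_left' hgm.stronglyMeasurable).measurable
    have hFB : ∀ y, |F y| ≤ B := fun y => by
      have := norm_integral_le_of_norm_le_const (μ := μ) (f := fun x => g (x, y)) (C := B)
        (ae_of_all _ fun x => hgB _)
      simpa using this
    have hFc : ∀ y i v, |F (Function.update y i v) - F y| ≤ c := fun y i v => by
      rw [hF]
      simp only
      rw [← integral_sub (hgi _) (hgi _)]
      have := norm_integral_le_of_norm_le_const (μ := μ)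
        (f := fun x => g (x, Function.update y i v) - g (x, y)) (C := c)
        (ae_of_all _ fun x => by
          simp only [hg, hes, Fin.cons_update]
          exact hc _ _ _)
      simpa using this
    have IH := hasSubgaussianMGF_of_bounded_difference_fin (μ := μ) hFm hFB hFc
    have hint : ∫ y, f y ∂(Measure.pi fun _ => μ) = ∫ y, F y ∂ν := by
      have h1 : ∫ y, f y ∂(Measure.pi fun _ => μ) = ∫ q, g q ∂(μ.prod ν) := by
        rw [← hmp.integral_comp' (f := e) g]
        simp [hg]
      rw [h1, integral_prod_symm _ (Integrable.of_bound hgm.aestronglyMeasurable B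
        (ae_of_all _ fun x => hgB _))]
    set m := ∫ y, F y ∂ν with hm
    have hbd : ∀ (t : ℝ), Integrable (fun q => Real.exp (t * (g q - m))) (μ.prod ν) := fun t => by
      refine Integrable.of_bound ((hgm.sub_const m).const_mul t).exp.aestronglyMeasurable
        (Real.exp (|t| * (B + |m|))) (ae_of_all _ fun q => ?_)
      rw [Real.norm_eq_abs, abs_of_pos (Real.exp_pos _)]
      apply Real.exp_le_exp.2
      refine (le_abs_self _).trans ?_
      rw [abs_mul]
      gcongr
      exact (abs_sub _ _).trans (by gcongr; exact hgB q)
    have hcomp : ∀ t : ℝ, (fun x => Real.exp (t * (f x - m))) =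
        (fun q => Real.exp (t * (g q - m))) ∘ e := fun t => by
      funext x; simp [hg]
    rw [hint]
    refine ⟨fun t => ?_, fun t => ?_⟩
    · rw [hcomp]
      exact (hmp.integrable_comp (hbd t).aestronglyMeasurable).2 (hbd t)
    · have hinner : ∀ y, ∫ x, Real.exp (t * (g (x, y) - F y)) ∂μ ≤ Real.exp (c ^ 2 * t ^ 2 / 2) := by
        -- Hoeffding's lemma on an interval of half-width `c` around the value at `0`. Its length `2
        -- * c`, rather than the optimal `c`, is the source of the lost factor.
        intro y
        have h := hasSubgaussianMGF_of_mem_Icc (μ := μ) (X := fun x => g (x, y))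
          (a := g (0, y) - c) (b := g (0, y) + c) (hgm1 y).aemeasurable (ae_of_all _ fun x => by
            have h := hc (e.symm (0, y)) 0 x
            have h2 : Function.update (e.symm (0, y)) 0 x = e.symm (x, y) := by
              rw [hes, hes, Fin.update_cons_zero]
            rw [h2, abs_le] at h
            constructor <;> simp only [hg] <;> linarith [h.1, h.2])
        have h3 := h.mgf_le t
        have h4 : (‖(g (0, y) + c) - (g (0, y) - c)‖₊ / 2) = c := by
          ext
          simp only [NNReal.coe_div, coe_nnnorm, Real.norm_eq_abs, NNReal.coe_ofNat]
          rw [show g (0, y) + (c : ℝ) - (g (0, y) - c) = 2 * c by ring,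
            abs_of_nonneg (by positivity)]
          ring
        rw [h4] at h3
        simpa [mgf] using h3
      have h5 : mgf (fun x => f x - m) (Measure.pi fun _ => μ) t =
          ∫ y, Real.exp (t * (F y - m)) * ∫ x, Real.exp (t * (g (x, y) - F y)) ∂μ ∂ν := by
        rw [mgf, hcomp]
        refine (hmp.integral_comp' (f := e) fun q => Real.exp (t * (g q - m))).trans ?_
        rw [integral_prod_symm _ (hbd t)]
        refine integral_congr_ae (ae_of_all _ fun y => ?_)
        simp only
        rw [← integral_const_mul]
        refine integral_congr_ae (ae_of_all _ fun x => ?_)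
        simp only
        rw [← Real.exp_add]
        ring_nf
      rw [h5]
      have hFi := IH.integrable_exp_mul t
      calc _ ≤ ∫ y, Real.exp (t * (F y - m)) * Real.exp (c ^ 2 * t ^ 2 / 2) ∂ν := by
            refine integral_mono_of_nonneg (ae_of_all _ fun y => ?_) (hFi.mul_const _)
              (ae_of_all _ fun y => ?_)
            · exact mul_nonneg (Real.exp_pos _).le (integral_nonneg fun x => (Real.exp_pos _).le)
            · exact mul_le_mul_of_nonneg_left (hinner y) (Real.exp_pos _).le
        _ = mgf (fun y => F y - m) ν t * Real.exp (c ^ 2 * t ^ 2 / 2) := by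
            rw [integral_mul_const]; rfl
        _ ≤ Real.exp ((n * c ^ 2 : NNReal) * t ^ 2 / 2) * Real.exp (c ^ 2 * t ^ 2 / 2) := by
            gcongr
            exact IH.mgf_le t
        _ = _ := by
            rw [← Real.exp_add]
            push_cast
            ring_nf

theorem hasSubgaussianMGF_of_bounded_difference {ι : Type} [Fintype ι] [DecidableEq ι]
    {μ : Measure ℝ} [IsProbabilityMeasure μ] {c : NNReal} {f : (ι → ℝ) → ℝ} {B : ℝ}
    (hf : Measurable f) (hB : ∀ x, |f x| ≤ B)
    (hc : ∀ x i v, |f (Function.update x i v) - f x| ≤ c) :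
    HasSubgaussianMGF (fun x => f x - ∫ y, f y ∂(Measure.pi fun _ => μ))
      (Fintype.card ι * c ^ 2) (Measure.pi fun _ : ι => μ) := by
  set k := Fintype.equivFin ι
  set e := MeasurableEquiv.piCongrLeft (fun _ : ι => ℝ) k.symm with he
  have hmp : MeasurePreserving e (Measure.pi fun _ => μ) (Measure.pi fun _ => μ) :=
    measurePreserving_piCongrLeft (fun _ : ι => μ) k.symm
  have heq : ∀ x i, e x i = x (k i) := fun x i => by
    have := MeasurableEquiv.piCongrLeft_apply_apply k.symm (β := fun _ => ℝ) x (k i)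
    simpa using this
  have hup : ∀ x i v, e (Function.update x i v) = Function.update (e x) (k.symm i) v := by
    intro x i v
    funext j
    simp only [heq, Function.update_apply, Equiv.eq_symm_apply]
  have key := hasSubgaussianMGF_of_bounded_difference_fin (μ := μ) (c := c)
    (f := fun x => f (e x)) (B := B) (hf.comp e.measurable) (fun x => hB _) (fun x i v => by
      rw [hup]; exact hc _ _ _)
  have hi : ∫ x, f (e x) ∂(Measure.pi fun _ => μ) = ∫ y, f y ∂(Measure.pi fun _ => μ) :=
    hmp.integral_comp' f
  rw [hi] at key
  rw [← (MeasurePreserving.symm e hmp).map_eq] at key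
  have h := HasSubgaussianMGF.of_map e.symm.measurable.aemeasurable key
  simpa [Function.comp_def] using h

/-- **McDiarmid's inequality** with equal constants (and a suboptimal factor in the exponent). -/
theorem measureReal_abs_sub_ge_le_of_bounded_difference {ι : Type} [Fintype ι] [DecidableEq ι]
    {μ : Measure ℝ} [IsProbabilityMeasure μ] {c : NNReal} {f : (ι → ℝ) → ℝ} {B : ℝ}
    (hf : Measurable f) (hB : ∀ x, |f x| ≤ B)
    (hc : ∀ x i v, |f (Function.update x i v) - f x| ≤ c) {t : ℝ} (ht : 0 ≤ t) :
    (Measure.pi fun _ : ι => μ).real {x | t ≤ |f x - ∫ y, f y ∂(Measure.pi fun _ => μ)|} ≤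
      2 * Real.exp (-t ^ 2 / (2 * (Fintype.card ι * c ^ 2))) := by
  have h := hasSubgaussianMGF_of_bounded_difference (μ := μ) hf hB hc
  have h1 := h.measure_ge_le ht
  have h2 := h.neg.measure_ge_le ht
  push_cast at h1 h2
  calc _ ≤ (Measure.pi fun _ : ι => μ).real ({x | t ≤ f x - ∫ y, f y ∂(Measure.pi fun _ => μ)} ∪
          {x | t ≤ (-fun x => f x - ∫ y, f y ∂(Measure.pi fun _ => μ)) x}) := by
        refine measureReal_mono fun x hx => ?_
        rcases le_abs.1 (show t ≤ |_| from hx) with h | h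
        · exact Or.inl h
        · exact Or.inr h
    _ ≤ _ := measureReal_union_le _ _
    _ ≤ _ := by linarith

/-! ### Fourier coordinates -/

theorem fourier_neg {p : ℕ} (θ : Freq p → ℝ) (j : Freq p) :
    fourier θ (-j) = conj (fourier θ j) := by
  have h0 := j.toInt_ne_zero
  by_cases hj : 0 < j.toInt
  · have hj' : ¬ 0 < (-j).toInt := by rw [Freq.toInt_neg]; omega
    simp [fourier, hj, hj', Freq.neg_neg, sub_eq_add_neg]
  · have hj' : 0 < (-j).toInt := by rw [Freq.toInt_neg]; omega
    simp [fourier, hj, hj', Freq.neg_neg]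

theorem fourier_mul_fourier_neg {p : ℕ} (θ : Freq p → ℝ) (j : Freq p) :
    fourier θ j * fourier θ (-j) = ((‖fourier θ j‖ ^ 2 : ℝ) : ℂ) := by
  rw [fourier_neg, Complex.mul_conj, Complex.normSq_eq_norm_sq]

theorem norm_fourier_neg {p : ℕ} (θ : Freq p → ℝ) (j : Freq p) :
    ‖fourier θ (-j)‖ = ‖fourier θ j‖ := by
  rw [fourier_neg, RCLike.norm_conj]

theorem norm_fourier_sq {p : ℕ} (θ : Freq p → ℝ) (j : Freq p) :
    ‖fourier θ j‖ ^ 2 = (θ j ^ 2 + θ (-j) ^ 2) / 2 := by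
  have key : ∀ x y : ℝ, ‖((x : ℂ) + Complex.I * y) / (Real.sqrt 2 : ℂ)‖ ^ 2 =
      (x ^ 2 + y ^ 2) / 2 := fun x y => by
    rw [norm_div, div_pow, Complex.norm_real, Real.norm_eq_abs, sq_abs,
      Real.sq_sqrt (by norm_num), ← Complex.normSq_eq_norm_sq, mul_comm Complex.I,
      Complex.normSq_add_mul_I]
  have h0 := j.toInt_ne_zero
  by_cases hj : 0 < j.toInt
  · rw [fourier, if_pos hj, key]
  · have hj' : 0 < (-j).toInt := by rw [Freq.toInt_neg]; omega
    rw [← norm_fourier_neg, fourier, if_pos hj', key, Freq.neg_neg, add_comm]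

theorem Delta_conjTranspose_mul (p : ℕ) : (Delta p)ᴴ * Delta p = 1 :=
  mul_eq_one_comm.1 (Delta_mul_conjTranspose p)

theorem Delta_conjTranspose_mulVec {p : ℕ} (θ : Freq p → ℝ) :
    (Delta p)ᴴ *ᵥ (fun j => (θ j : ℂ)) = fourier θ := by
  rw [← Delta_mulVec_fourier, Matrix.mulVec_mulVec, Delta_conjTranspose_mul, Matrix.one_mulVec]

theorem fourier_rotate {p : ℕ} (g : ℝ) (θ : Freq p → ℝ) (j : Freq p) :
    fourier (rotate g θ) j = Complex.exp (Complex.I * j.toInt * g) * fourier θ j := by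
  have hpos : ∀ j : Freq p, 0 < j.toInt →
      fourier (rotate g θ) j = Complex.exp (Complex.I * j.toInt * g) * fourier θ j := by
    intro j hj
    rw [show Complex.I * j.toInt * g = ((j.toInt * g : ℝ) : ℂ) * Complex.I by push_cast; ring,
      Complex.exp_mul_I, ← Complex.ofReal_cos, ← Complex.ofReal_sin]
    simp only [fourier, if_pos hj, rotate, Freq.toInt_neg, Freq.neg_neg]
    push_cast
    rw [neg_mul, Complex.cos_neg, Complex.sin_neg]
    linear_combination (-(Complex.sin (j.toInt * g) * θ (-j)) / (Real.sqrt 2 : ℂ)) * Complex.I_sq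
  by_cases hj : 0 < j.toInt
  · exact hpos j hj
  · have h0 := j.toInt_ne_zero
    have h := hpos (-j) (by rw [Freq.toInt_neg]; omega)
    rw [fourier_neg, fourier_neg] at h
    have h2 := congrArg conj h
    rw [Complex.conj_conj, map_mul, Complex.conj_conj, ← Complex.exp_conj] at h2
    rw [h2, Freq.toInt_neg]
    congr 2
    simp

theorem tensorFourier_tensorPow {p d : ℕ} (θ : Freq p → ℝ) (x : Fin d → Freq p) :
    tensorFourier (tensorPow d θ) x = ∏ l, fourier θ (x l) := by
  simp only [← Delta_conjTranspose_mulVec θ, Matrix.mulVec, dotProduct]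
  rw [Finset.prod_univ_sum, Fintype.piFinset_univ, tensorFourier]
  refine Finset.sum_congr rfl fun y _ => ?_
  rw [Finset.prod_mul_distrib, tensorPow]
  push_cast
  rfl

theorem integral_exp_int_mul (n : ℤ) :
    ∫ g in (0 : ℝ)..(2 * Real.pi), Complex.exp (Complex.I * n * g) =
      if n = 0 then 2 * (Real.pi : ℂ) else 0 := by
  split_ifs with hn
  · simp [hn]
  · rw [integral_exp_mul_complex (mul_ne_zero Complex.I_ne_zero (by exact_mod_cast hn))]
    rw [show Complex.I * n * ((2 * Real.pi : ℝ) : ℂ) = n * (2 * Real.pi * Complex.I) by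
      push_cast; ring, Complex.exp_int_mul_two_pi_mul_I]
    simp

/-- The three phases multiply to a character of the circle, whose mean is one or zero according to
whether the total frequency vanishes. -/
theorem tensorFourier_thirdMoment {p : ℕ} (θ : Freq p → ℝ) (x : Fin 3 → Freq p) :
    tensorFourier (thirdMoment θ) x =
      if ∑ l, (x l).toInt = 0 then ∏ l, fourier θ (x l) else 0 := by
  have hcont : ∀ y : Fin 3 → Freq p, Continuous fun g : ℝ => tensorPow 3 (rotate g θ) y := by
    intro y
    unfold tensorPow rotate
    fun_prop
  have h1 : tensorFourier (thirdMoment θ) x = (2 * (Real.pi : ℂ))⁻¹ *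
      ∫ g in (0 : ℝ)..(2 * Real.pi), tensorFourier (tensorPow 3 (rotate g θ)) x := by
    simp only [tensorFourier]
    rw [intervalIntegral.integral_finsetSum, Finset.mul_sum]
    · refine Finset.sum_congr rfl fun y _ => ?_
      rw [intervalIntegral.integral_const_mul, intervalIntegral.integral_ofReal, thirdMoment]
      push_cast
      ring
    · intro y _
      refine Continuous.intervalIntegrable ?_ _ _
      exact continuous_const.mul (Complex.continuous_ofReal.comp (hcont y))
  have h2 : ∀ g : ℝ, tensorFourier (tensorPow 3 (rotate g θ)) x =
      Complex.exp (Complex.I * (∑ l, (x l).toInt : ℤ) * g) * ∏ l, fourier θ (x l) := by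
    intro g
    simp only [tensorFourier_tensorPow, fourier_rotate]
    rw [Finset.prod_mul_distrib, ← Complex.exp_sum]
    congr 2
    push_cast
    rw [Finset.mul_sum, Finset.sum_mul]
  simp only [h1, h2]
  rw [intervalIntegral.integral_mul_const, integral_exp_int_mul]
  split_ifs with h
  · have : (2 * (Real.pi : ℂ)) ≠ 0 := by simp [Real.pi_ne_zero]
    field_simp
  · simp

theorem tensorFourier_thirdMoment_vec {p : ℕ} (θ : Freq p → ℝ) (x y z : Freq p) :
    tensorFourier (thirdMoment θ) ![x, y, z] =
      if x.toInt + y.toInt + z.toInt = 0 then fourier θ x * fourier θ y * fourier θ z else 0 := by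
  rw [tensorFourier_thirdMoment, Fin.sum_univ_three, Fin.prod_univ_three]
  rfl

/-- Each `i` index occurs at two adjacent vertices with opposite signs, and each `j` index is paired
with `-j` in the fifth-order tensor. As conjugation is negation of the index, these pairs become
squared moduli, and only the four open legs survive. -/
theorem networkHat_apply {p : ℕ} (θ : Freq p → ℝ) (a b c d : Freq p) :
    networkHat (thirdMoment θ) (tensorPow 5 θ) (a, b) (c, d) =
      (correction a b c d * sCoeff θ a b c d : ℝ) *
        (fourier θ a * fourier θ b * (fourier θ c * fourier θ d)) := by
  simp only [networkHat, Matrix.of_apply, sCoeff]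
  push_cast
  rw [mul_assoc]
  congr 1
  rw [Finset.sum_mul]
  refine Finset.sum_congr rfl fun i _ => ?_
  rw [Finset.sum_mul]
  refine Finset.sum_congr rfl fun j _ => ?_
  by_cases hZ : ZeroSum a b c d i j
  · obtain ⟨z1, z2, z3, z4, z5, z6, z7, z8, z9⟩ := id hZ
    have e : ∀ k, (‖fourier θ k‖ : ℂ) ^ 2 = fourier θ k * fourier θ (-k) := fun k => by
      rw [fourier_mul_fourier_neg]; push_cast; rfl
    have hv : ∀ x y z : Freq p, -x.toInt + y.toInt + z.toInt = 0 →
        tensorFourier (thirdMoment θ) ![-x, y, z] = fourier θ (-x) * fourier θ y * fourier θ z :=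
      fun x y z h => by rw [tensorFourier_thirdMoment_vec, if_pos (by rw [Freq.toInt_neg, h])]
    rw [if_pos hZ, hv _ _ _ z1, hv _ _ _ z2, hv _ _ _ z3, hv _ _ _ z4, hv _ _ _ z5, hv _ _ _ z6,
      hv _ _ _ z7, hv _ _ _ z8, hv _ _ _ z9, tensorFourier_tensorPow]
    simp only [e, Fin.prod_univ_succ, Fin.prod_univ_zero]
    simp
    ring
  · rw [if_neg hZ, Complex.ofReal_zero, zero_mul, zero_mul]
    -- Were the product nonzero, all nine vertex factors would be nonzero, which forces every
    -- zero-sum equation.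
    by_contra hne
    have hz : ∀ x y z : Freq p, tensorFourier (thirdMoment θ) ![x, y, z] ≠ 0 →
        x.toInt + y.toInt + z.toInt = 0 := fun x y z h => by
      by_contra h0
      exact h (by rw [tensorFourier_thirdMoment_vec, if_neg h0])
    simp only [mul_eq_zero, not_or] at hne
    obtain ⟨⟨⟨⟨⟨⟨⟨⟨⟨-, n1⟩, n2⟩, n3⟩, n4⟩, n5⟩, n6⟩, n7⟩, n8⟩, n9⟩ := hne
    exact hZ ⟨hz _ _ _ n1, hz _ _ _ n2, hz _ _ _ n3, hz _ _ _ n4, hz _ _ _ n5, hz _ _ _ n6,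
      hz _ _ _ n7, hz _ _ _ n8, hz _ _ _ n9⟩

/-! ### Spectral norms -/

theorem matrixSpectralNorm_le_sqrt {n : Type} [Fintype n] [DecidableEq n] (A : Matrix n n ℂ) :
    matrixSpectralNorm A ≤ √(∑ i, ∑ j, ‖A i j‖ ^ 2) := by
  refine ContinuousLinearMap.opNorm_le_bound _ (Real.sqrt_nonneg _) fun x => ?_
  rw [EuclideanSpace.norm_eq, EuclideanSpace.norm_eq, ← Real.sqrt_mul (by positivity),
    Finset.sum_mul]
  refine Real.sqrt_le_sqrt (Finset.sum_le_sum fun i _ => ?_)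
  rw [Matrix.ofLp_toEuclideanCLM]
  calc _ ≤ (∑ j, ‖A i j‖ * ‖x j‖) ^ 2 := by
        gcongr
        exact (norm_sum_le _ _).trans (by simp)
    _ ≤ _ := Finset.sum_mul_sq_le_sq_mul_sq _ _ _

theorem matrixSpectralNorm_unitary_mul_mul {n : Type} [Fintype n] [DecidableEq n]
    {U V : Matrix n n ℂ} (hU : U ∈ unitary (Matrix n n ℂ)) (hV : V ∈ unitary (Matrix n n ℂ))
    (A : Matrix n n ℂ) : matrixSpectralNorm (U * A * V) = matrixSpectralNorm A := by
  rw [matrixSpectralNorm, map_mul, map_mul,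
    CStarRing.norm_mul_mem_unitary _ (Unitary.map_mem (Matrix.toEuclideanCLM (n := n) (𝕜 := ℂ)) hV),
    CStarRing.norm_mem_unitary_mul _ (Unitary.map_mem (Matrix.toEuclideanCLM (n := n) (𝕜 := ℂ)) hU)]
  rfl

theorem Delta_mem_unitary (p : ℕ) : Delta p ∈ unitary (Matrix (Freq p) (Freq p) ℂ) :=
  Unitary.mem_iff.2 ⟨Delta_conjTranspose_mul p, Delta_mul_conjTranspose p⟩

theorem transpose_mem_unitary {n : Type} [Fintype n] [DecidableEq n] {U : Matrix n n ℂ}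
    (hU : U ∈ unitary (Matrix n n ℂ)) : Uᵀ ∈ unitary (Matrix n n ℂ) := by
  obtain ⟨h1, h2⟩ := Unitary.mem_iff.1 hU
  refine Unitary.mem_iff.2 ⟨?_, ?_⟩
  · rw [show star Uᵀ = (star U)ᵀ from rfl, ← Matrix.transpose_mul, h2, Matrix.transpose_one]
  · rw [show star Uᵀ = (star U)ᵀ from rfl, ← Matrix.transpose_mul, h1, Matrix.transpose_one]

/-- The target has rank one, so the change of basis can be applied to its generating vector. This
puts it in the same form as the network matrix, with every `S s` replaced by one. -/
theorem targetMatrix_map {p : ℕ} (θ : Freq p → ℝ) :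
    (targetMatrix θ).map (fun x : ℝ => (x : ℂ)) =
      (Delta p ⊗ₖ Delta p) * Matrix.vecMulVec (fun ab => fourier θ ab.1 * fourier θ ab.2)
        (fun cd => fourier θ cd.1 * fourier θ cd.2) * (Delta p ⊗ₖ Delta p)ᵀ := by
  have h : (Delta p ⊗ₖ Delta p) *ᵥ (fun ab => fourier θ ab.1 * fourier θ ab.2) =
      fun ab => (θ ab.1 : ℂ) * θ ab.2 := by
    funext ab
    have h1 := fun k => congrFun (Delta_mulVec_fourier θ) k
    simp only [Matrix.mulVec, dotProduct] at h1
    rw [← h1, ← h1, Finset.sum_mul_sum, Matrix.mulVec, dotProduct, Fintype.sum_prod_type]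
    refine Finset.sum_congr rfl fun x _ => Finset.sum_congr rfl fun y _ => ?_
    rw [Matrix.kronecker_apply]
    ring
  rw [Matrix.mul_vecMulVec, Matrix.vecMulVec_mul, Matrix.vecMul_transpose, h]
  ext ab cd
  simp [targetMatrix, Matrix.vecMulVec_apply]

theorem matrixSpectralNorm_networkMatrix_sub_le {p : ℕ} (θ : Freq p → ℝ) :
    matrixSpectralNorm (networkMatrix (thirdMoment θ) (tensorPow 5 θ) -
        (targetMatrix θ).map (fun x : ℝ => (x : ℂ))) ≤
      √(∑ ab : Freq p × Freq p, ∑ cd : Freq p × Freq p,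
        (correction ab.1 ab.2 cd.1 cd.2 * sCoeff θ ab.1 ab.2 cd.1 cd.2 - 1) ^ 2 *
          (‖fourier θ ab.1‖ ^ 2 * ‖fourier θ ab.2‖ ^ 2 *
            (‖fourier θ cd.1‖ ^ 2 * ‖fourier θ cd.2‖ ^ 2))) := by
  have hK := Matrix.kronecker_mem_unitary (Delta_mem_unitary p) (Delta_mem_unitary p)
  rw [targetMatrix_map, networkMatrix, ← Matrix.sub_mul, ← Matrix.mul_sub,
    matrixSpectralNorm_unitary_mul_mul hK (transpose_mem_unitary hK)]
  refine (matrixSpectralNorm_le_sqrt _).trans (le_of_eq ?_)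
  congr 1
  refine Finset.sum_congr rfl fun ab _ => Finset.sum_congr rfl fun cd _ => ?_
  obtain ⟨a, b⟩ := ab
  obtain ⟨c, d⟩ := cd
  rw [Matrix.sub_apply, networkHat_apply, Matrix.vecMulVec_apply, ← sub_one_mul, norm_mul,
    mul_pow, ← Complex.ofReal_one, ← Complex.ofReal_sub, Complex.norm_real, Real.norm_eq_abs,
    sq_abs]
  simp only [norm_mul, mul_pow]

/-! ### Counting the tuples that satisfy the zero-sum constraints -/

theorem Freq.bounds {p : ℕ} (j : Freq p) :
    -((p / 2 : ℕ) : ℤ) ≤ j.toInt ∧ j.toInt ≤ ((p / 2 : ℕ) : ℤ) :=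
  Finset.mem_Icc.1 (Finset.mem_erase.1 j.2).2

theorem Freq.exists_toInt_eq {p : ℕ} {v : ℤ} (h0 : v ≠ 0) (h1 : -((p / 2 : ℕ) : ℤ) ≤ v)
    (h2 : v ≤ ((p / 2 : ℕ) : ℤ)) : ∃ j : Freq p, j.toInt = v :=
  ⟨⟨v, Finset.mem_erase.2 ⟨h0, Finset.mem_Icc.2 ⟨h1, h2⟩⟩⟩, rfl⟩

theorem card_freq_le (p : ℕ) : Fintype.card (Freq p) ≤ p := by
  have h : Fintype.card (Freq p) =
      ((Finset.Icc (-((p / 2 : ℕ) : ℤ)) ((p / 2 : ℕ) : ℤ)).erase 0).card := Fintype.card_coe _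
  rw [h, Finset.card_erase_of_mem (Finset.mem_Icc.2 (by omega)), Int.card_Icc]
  omega

/-- The index set of a tuple `(i, j)`. -/
abbrev Slot : Type := Fin 9 ⊕ Fin 5

open Classical in
/-- The tuples `(i, j)` satisfying the zero-sum constraints. -/
def zeroSumTuples {p : ℕ} (a b c d : Freq p) : Finset (Slot → Freq p) :=
  Finset.univ.filter fun z => ZeroSum a b c d (fun l => z (.inl l)) (fun l => z (.inr l))

theorem mem_zeroSumTuples {p : ℕ} {a b c d : Freq p} {z : Slot → Freq p} :
    z ∈ zeroSumTuples a b c d ↔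
      -(z (.inl 0)).toInt + a.toInt + (z (.inl 1)).toInt = 0 ∧
      -(z (.inl 1)).toInt + (z (.inr 0)).toInt + (z (.inl 2)).toInt = 0 ∧
      -(z (.inl 2)).toInt + c.toInt + (z (.inl 3)).toInt = 0 ∧
      -(z (.inl 3)).toInt + (z (.inr 1)).toInt + (z (.inl 4)).toInt = 0 ∧
      -(z (.inl 4)).toInt + b.toInt + (z (.inl 5)).toInt = 0 ∧
      -(z (.inl 5)).toInt + (z (.inr 2)).toInt + (z (.inl 6)).toInt = 0 ∧
      -(z (.inl 6)).toInt + d.toInt + (z (.inl 7)).toInt = 0 ∧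
      -(z (.inl 7)).toInt + (z (.inr 3)).toInt + (z (.inl 8)).toInt = 0 ∧
      -(z (.inl 8)).toInt + (z (.inr 4)).toInt + (z (.inl 0)).toInt = 0 := by
  simp only [zeroSumTuples, Finset.mem_filter, Finset.mem_univ, true_and]
  rfl

theorem sCoeff_eq_sum {p : ℕ} (θ : Freq p → ℝ) (a b c d : Freq p) :
    sCoeff θ a b c d = ∑ z ∈ zeroSumTuples a b c d, ∏ l, ‖fourier θ (z l)‖ ^ 2 := by
  rw [zeroSumTuples, Finset.sum_filter, sCoeff, ← Fintype.sum_prod_type',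
    ← (Equiv.sumArrowEquivProdArrow (Fin 9) (Fin 5) (Freq p)).sum_comp]
  refine Finset.sum_congr rfl fun z _ => ?_
  rw [ite_mul, one_mul, zero_mul, Fintype.prod_sum_type]
  rfl

/-- Walking around the ring from `i 0`, each equation determines the next index; the closing
equation gives `j 4`. Hence there are five degrees of freedom. -/
theorem eq_of_mem_zeroSumTuples {p : ℕ} {a b c d : Freq p} {z z' : Slot → Freq p}
    (hz : z ∈ zeroSumTuples a b c d) (hz' : z' ∈ zeroSumTuples a b c d)
    (h : (z (.inl 0)).toInt = (z' (.inl 0)).toInt) (h0 : (z (.inr 0)).toInt = (z' (.inr 0)).toInt)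
    (h1 : (z (.inr 1)).toInt = (z' (.inr 1)).toInt) (h2 : (z (.inr 2)).toInt = (z' (.inr 2)).toInt)
    (h3 : (z (.inr 3)).toInt = (z' (.inr 3)).toInt) : z = z' := by
  obtain ⟨a1, a2, a3, a4, a5, a6, a7, a8, a9⟩ := mem_zeroSumTuples.1 hz
  obtain ⟨b1, b2, b3, b4, b5, b6, b7, b8, b9⟩ := mem_zeroSumTuples.1 hz'
  have i1 : (z (.inl 1)).toInt = (z' (.inl 1)).toInt := by omega
  have i2 : (z (.inl 2)).toInt = (z' (.inl 2)).toInt := by omega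
  have i3 : (z (.inl 3)).toInt = (z' (.inl 3)).toInt := by omega
  have i4 : (z (.inl 4)).toInt = (z' (.inl 4)).toInt := by omega
  have i5 : (z (.inl 5)).toInt = (z' (.inl 5)).toInt := by omega
  have i6 : (z (.inl 6)).toInt = (z' (.inl 6)).toInt := by omega
  have i7 : (z (.inl 7)).toInt = (z' (.inl 7)).toInt := by omega
  have i8 : (z (.inl 8)).toInt = (z' (.inl 8)).toInt := by omega
  have h4 : (z (.inr 4)).toInt = (z' (.inr 4)).toInt := by omega
  funext l
  apply Freq.toInt_injective
  rcases l with l | l <;> fin_cases l <;> assumption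

/-- Any slot can be taken as one of five coordinates on the solution set, so fixing a slot always
costs a full factor `p`. The difference bound for `s_abcd` depends on this. -/
theorem exists_determining_slots {p : ℕ} (a b c d : Freq p) (l : Slot) :
    ∃ e : Fin 4 → Slot, ∀ z ∈ zeroSumTuples a b c d, ∀ z' ∈ zeroSumTuples a b c d,
      z l = z' l → (∀ k, z (e k) = z' (e k)) → z = z' := by
  rcases l with l | l
  · refine ⟨![.inr 0, .inr 1, .inr 2, .inr 3], fun z hz z' hz' hl he => ?_⟩
    obtain ⟨a1, a2, a3, a4, a5, a6, a7, a8, a9⟩ := mem_zeroSumTuples.1 hz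
    obtain ⟨b1, b2, b3, b4, b5, b6, b7, b8, b9⟩ := mem_zeroSumTuples.1 hz'
    have e0 := congrArg Freq.toInt (he 0)
    have e1 := congrArg Freq.toInt (he 1)
    have e2 := congrArg Freq.toInt (he 2)
    have e3 := congrArg Freq.toInt (he 3)
    have hl' := congrArg Freq.toInt hl
    simp only [Matrix.cons_val] at e0 e1 e2 e3
    refine eq_of_mem_zeroSumTuples hz hz' ?_ e0 e1 e2 e3
    fin_cases l <;> simp only [Fin.zero_eta, Fin.mk_one, Fin.reduceFinMk] at hl' <;> omega
  · fin_cases l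
    · refine ⟨![.inl 0, .inr 1, .inr 2, .inr 3], fun z hz z' hz' hl he => ?_⟩
      exact eq_of_mem_zeroSumTuples hz hz' (congrArg Freq.toInt (he 0)) (congrArg Freq.toInt hl)
        (congrArg Freq.toInt (he 1)) (congrArg Freq.toInt (he 2)) (congrArg Freq.toInt (he 3))
    · refine ⟨![.inl 0, .inr 0, .inr 2, .inr 3], fun z hz z' hz' hl he => ?_⟩
      exact eq_of_mem_zeroSumTuples hz hz' (congrArg Freq.toInt (he 0)) (congrArg Freq.toInt (he 1))
        (congrArg Freq.toInt hl) (congrArg Freq.toInt (he 2)) (congrArg Freq.toInt (he 3))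
    · refine ⟨![.inl 0, .inr 0, .inr 1, .inr 3], fun z hz z' hz' hl he => ?_⟩
      exact eq_of_mem_zeroSumTuples hz hz' (congrArg Freq.toInt (he 0)) (congrArg Freq.toInt (he 1))
        (congrArg Freq.toInt (he 2)) (congrArg Freq.toInt hl) (congrArg Freq.toInt (he 3))
    · refine ⟨![.inl 0, .inr 0, .inr 1, .inr 2], fun z hz z' hz' hl he => ?_⟩
      exact eq_of_mem_zeroSumTuples hz hz' (congrArg Freq.toInt (he 0)) (congrArg Freq.toInt (he 1))
        (congrArg Freq.toInt (he 2)) (congrArg Freq.toInt (he 3)) (congrArg Freq.toInt hl)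
    -- With `j 4` given, the closing equation yields `i 8`, and then `j 3` is the difference of `i
    -- 7` and `i 8`.
    · refine ⟨![.inl 0, .inr 0, .inr 1, .inr 2], fun z hz z' hz' hl he => ?_⟩
      obtain ⟨a1, a2, a3, a4, a5, a6, a7, a8, a9⟩ := mem_zeroSumTuples.1 hz
      obtain ⟨b1, b2, b3, b4, b5, b6, b7, b8, b9⟩ := mem_zeroSumTuples.1 hz'
      have e0 := congrArg Freq.toInt (he 0)
      have e1 := congrArg Freq.toInt (he 1)
      have e2 := congrArg Freq.toInt (he 2)
      have e3 := congrArg Freq.toInt (he 3)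
      have hl' := congrArg Freq.toInt hl
      simp only [Matrix.cons_val] at e0 e1 e2 e3
      simp only [Fin.reduceFinMk] at hl'
      refine eq_of_mem_zeroSumTuples hz hz' e0 e1 e2 e3 ?_
      omega

theorem card_filter_zeroSumTuples_le {p : ℕ} (a b c d : Freq p) (l : Slot) (m : Freq p) :
    ((zeroSumTuples a b c d).filter fun z => z l = m).card ≤ p ^ 4 := by
  obtain ⟨e, he⟩ := exists_determining_slots a b c d l
  calc _ ≤ (Finset.univ : Finset (Fin 4 → Freq p)).card := by
        refine Finset.card_le_card_of_injOn (fun z k => z (e k)) (fun _ _ => Finset.mem_univ _) ?_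
        intro z hz z' hz' h
        simp only [Finset.coe_filter, Set.mem_ofPred_eq] at hz hz'
        exact he z hz.1 z' hz'.1 (hz.2.trans hz'.2.symm) fun k => congrFun h k
    _ ≤ p ^ 4 := by
        rw [Finset.card_univ, Fintype.card_fun, Fintype.card_fin]
        exact Nat.pow_le_pow_left (card_freq_le p) 4

theorem card_zeroSumTuples_le {p : ℕ} (a b c d : Freq p) :
    (zeroSumTuples a b c d).card ≤ p ^ 5 := by
  rw [Finset.card_eq_sum_card_fiberwise (f := fun z => z (.inl 0)) (t := Finset.univ)
    fun _ _ => by simp]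
  calc _ ≤ ∑ _m : Freq p, p ^ 4 :=
        Finset.sum_le_sum fun m _ => card_filter_zeroSumTuples_le a b c d (.inl 0) m
    _ ≤ p ^ 5 := by
        rw [Finset.sum_const, Finset.card_univ, smul_eq_mul, pow_succ' p 4]
        exact Nat.mul_le_mul_right _ (card_freq_le p)

/-- Four consecutive integers meet every class modulo 4, and three are excluded. This keeps the
constructed indices away from zero, which is not a frequency. -/
theorem exists_avoiding_residues (lo u v w : ℤ) :
    ∃ β, lo ≤ β ∧ β < lo + 4 ∧ (β - u) % 4 ≠ 0 ∧ (β - v) % 4 ≠ 0 ∧ (β - w) % 4 ≠ 0 := by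
  by_contra! h
  have h0 := h lo
  have h1 := h (lo + 1)
  have h2 := h (lo + 2)
  have h3 := h (lo + 3)
  omega

theorem add_four_mul_ne {β u : ℤ} (h : (β - u) % 4 ≠ 0) (x y : ℤ) : β + 4 * x ≠ u + 4 * y := by
  omega

/-- Near `a / 2` both `u` and `u - a` are about `h / 2` or less in size, leaving room for an offset
of up to `7 * D`. -/
theorem half_add_bounds {h D a T u : ℤ} (hD : 16 * D ≤ h) (h1 : -h ≤ a) (h2 : a ≤ h)
    (hT1 : -(6 * D) ≤ T) (hT2 : T ≤ 6 * D) (hu1 : a / 2 + T ≤ u) (hu2 : u < a / 2 + T + D) :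
    -h ≤ u ∧ u ≤ h ∧ -h ≤ u - a ∧ u - a ≤ h := by
  omega

/-- The difference is `-(a + c) / 2 + (T - T')` up to about `D`. Its first term can be as large as
`h` in size, so the shift by `2 * D` is chosen to push it back towards zero. -/
theorem half_sub_half_bounds {h D a c T T' u v : ℤ} (hD : 16 * D ≤ h)
    (h1 : -h ≤ a) (h2 : a ≤ h) (h3 : -h ≤ c) (h4 : c ≤ h)
    (hT : (0 ≤ a + c ∧ T' = T - 2 * D) ∨ (a + c ≤ 0 ∧ T' = T + 2 * D))
    (hu1 : a / 2 + T ≤ u) (hu2 : u < a / 2 + T + D)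
    (hv1 : c / 2 + T' ≤ v) (hv2 : v < c / 2 + T' + D) :
    -h ≤ u - a - v ∧ u - a - v ≤ h := by
  omega

theorem exists_shift (D v T : ℤ) :
    ∃ T', (0 ≤ v ∧ T' = T - 2 * D) ∨ (v ≤ 0 ∧ T' = T + 2 * D) := by
  rcases le_total 0 v with h | h
  · exact ⟨_, .inl ⟨h, rfl⟩⟩
  · exact ⟨_, .inr ⟨h, rfl⟩⟩

/-- The free indices `i 0`, `i 2`, `i 4`, `i 6`, `i 8` range over progressions of step 4 and length
`m`, starting near `a / 2`, `c / 2`, `b / 2`, `d / 2` and `0`. All other indices are differences of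
these, kept in range by the shifts and nonzero by the residues. -/
theorem le_card_zeroSumTuples {p : ℕ} (hp : 256 ≤ p) (a b c d : Freq p) :
    (p / 2 / 128) ^ 5 ≤ (zeroSumTuples a b c d).card := by
  obtain ⟨m, hm⟩ : ∃ m, m = p / 2 / 128 := ⟨_, rfl⟩
  obtain ⟨a1, a2⟩ := a.bounds
  obtain ⟨b1, b2⟩ := b.bounds
  obtain ⟨c1, c2⟩ := c.bounds
  obtain ⟨d1, d2⟩ := d.bounds
  obtain ⟨h, hh⟩ : ∃ h : ℤ, h = ((p / 2 : ℕ) : ℤ) := ⟨_, rfl⟩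
  -- `D` bounds the window containing a progression and its starting residue; `16 * D ≤ h` needs `m
  -- ≥ 1`, hence `p ≥ 256`.
  obtain ⟨D, hD⟩ : ∃ D : ℤ, D = 4 * (m : ℤ) + 4 := ⟨_, rfl⟩
  have hDh : 16 * D ≤ h := by omega
  rw [← hm]
  rw [← hh] at a1 a2 b1 b2 c1 c2 d1 d2
  have hex : ∀ v : ℤ, v ≠ 0 → -h ≤ v → v ≤ h → ∃ j : Freq p, j.toInt = v := fun v h0 h1 h2 =>
    Freq.exists_toInt_eq h0 (hh ▸ h1) (hh ▸ h2)
  have hD0 : 4 ≤ D := by omega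
  clear hh hm hp
  obtain ⟨T1, hT1⟩ := exists_shift D (a.toInt + c.toInt) 0
  obtain ⟨T2, hT2⟩ := exists_shift D (c.toInt + b.toInt) T1
  obtain ⟨T3, hT3⟩ := exists_shift D (b.toInt + d.toInt) T2
  have hT1b : -(2 * D) ≤ T1 ∧ T1 ≤ 2 * D := by omega
  have hT2b : -(4 * D) ≤ T2 ∧ T2 ≤ 4 * D := by omega
  have hT3b : -(6 * D) ≤ T3 ∧ T3 ≤ 6 * D := by omega
  obtain ⟨β1, l1, u1, n11, n12, -⟩ := exists_avoiding_residues (a.toInt / 2 + 0) 0 a.toInt 0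
  obtain ⟨β2, l2, u2, n21, n22, n23⟩ :=
    exists_avoiding_residues (c.toInt / 2 + T1) 0 c.toInt (β1 - a.toInt)
  obtain ⟨β3, l3, u3, n31, n32, n33⟩ :=
    exists_avoiding_residues (b.toInt / 2 + T2) 0 b.toInt (β2 - c.toInt)
  obtain ⟨β4, l4, u4, n41, n42, n43⟩ :=
    exists_avoiding_residues (d.toInt / 2 + T3) 0 d.toInt (β3 - b.toInt)
  -- The excluded classes are those making `i 8`, `j 3` or `j 4` zero.
  obtain ⟨β5, l5, u5, n51, n52, n53⟩ := exists_avoiding_residues 0 0 (β4 - d.toInt) β1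
  have key : ∀ y : Fin 5 → Fin m, ∃ z ∈ zeroSumTuples a b c d,
      (z (.inl 0)).toInt = β1 + 4 * (y 0 : ℕ) ∧ (z (.inl 2)).toInt = β2 + 4 * (y 1 : ℕ) ∧
      (z (.inl 4)).toInt = β3 + 4 * (y 2 : ℕ) ∧ (z (.inl 6)).toInt = β4 + 4 * (y 3 : ℕ) ∧
      (z (.inl 8)).toInt = β5 + 4 * (y 4 : ℕ) := by
    intro y
    have window : ∀ {β lo : ℤ} (k : Fin 5), lo ≤ β → β < lo + 4 →
        lo ≤ β + 4 * ((y k : ℕ) : ℤ) ∧ β + 4 * ((y k : ℕ) : ℤ) < lo + D := fun k h1 h2 => by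
      have := (y k).2
      omega
    obtain ⟨v1, w1⟩ := window 0 l1 u1
    obtain ⟨v2, w2⟩ := window 1 l2 u2
    obtain ⟨v3, w3⟩ := window 2 l3 u3
    obtain ⟨v4, w4⟩ := window 3 l4 u4
    obtain ⟨v5, w5⟩ := window 4 l5 u5
    obtain ⟨r1, r2, r3, r4⟩ := half_add_bounds hDh a1 a2 (by linarith) (by linarith) v1 w1
    obtain ⟨r5, r6, r7, r8⟩ := half_add_bounds hDh c1 c2 (by linarith) (by linarith) v2 w2
    obtain ⟨r9, r10, r11, r12⟩ := half_add_bounds hDh b1 b2 (by linarith) (by linarith) v3 w3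
    obtain ⟨r13, r14, r15, r16⟩ := half_add_bounds hDh d1 d2 hT3b.1 hT3b.2 v4 w4
    obtain ⟨s1, s2⟩ := half_sub_half_bounds hDh a1 a2 c1 c2 hT1 v1 w1 v2 w2
    obtain ⟨s3, s4⟩ := half_sub_half_bounds hDh c1 c2 b1 b2 hT2 v2 w2 v3 w3
    obtain ⟨s5, s6⟩ := half_sub_half_bounds hDh b1 b2 d1 d2 hT3 v3 w3 v4 w4
    have s7 : -h ≤ β4 + 4 * ((y 3 : ℕ) : ℤ) - d.toInt - (β5 + 4 * ((y 4 : ℕ) : ℤ)) ∧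
        β4 + 4 * ((y 3 : ℕ) : ℤ) - d.toInt - (β5 + 4 * ((y 4 : ℕ) : ℤ)) ≤ h := by
      clear window
      generalize β4 + 4 * ((y 3 : ℕ) : ℤ) = u at *
      generalize β5 + 4 * ((y 4 : ℕ) : ℤ) = v at *
      clear * - hDh hD0 d1 d2 hT3b v4 w4 v5 w5
      omega
    have s8 : -h ≤ β5 + 4 * ((y 4 : ℕ) : ℤ) - (β1 + 4 * ((y 0 : ℕ) : ℤ)) ∧
        β5 + 4 * ((y 4 : ℕ) : ℤ) - (β1 + 4 * ((y 0 : ℕ) : ℤ)) ≤ h := by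
      generalize β1 + 4 * ((y 0 : ℕ) : ℤ) = u at *
      generalize β5 + 4 * ((y 4 : ℕ) : ℤ) = v at *
      clear * - hDh hD0 a1 a2 v1 w1 v5 w5
      omega
    have nz : ∀ {β u : ℤ} (x x' : ℤ), (β - u) % 4 ≠ 0 → u + 4 * x' - (β + 4 * x) ≠ 0 :=
      fun x x' h => sub_ne_zero.2 (add_four_mul_ne h x x').symm
    generalize ((y 0 : ℕ) : ℤ) = y0 at *
    generalize ((y 1 : ℕ) : ℤ) = y1 at *
    generalize ((y 2 : ℕ) : ℤ) = y2 at *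
    generalize ((y 3 : ℕ) : ℤ) = y3 at *
    generalize ((y 4 : ℕ) : ℤ) = y4 at *
    have z1 := add_four_mul_ne n11 y0 0
    have z2 := add_four_mul_ne n21 y1 0
    have z3 := add_four_mul_ne n31 y2 0
    have z4 := add_four_mul_ne n41 y3 0
    have z5 := add_four_mul_ne n51 y4 0
    have z1' := add_four_mul_ne n12 y0 0
    have z2' := add_four_mul_ne n22 y1 0
    have z3' := add_four_mul_ne n32 y2 0
    have z4' := add_four_mul_ne n42 y3 0
    have q1 := add_four_mul_ne n23 y1 y0
    have q2 := add_four_mul_ne n33 y2 y1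
    have q3 := add_four_mul_ne n43 y3 y2
    have q4 := add_four_mul_ne n52 y4 y3
    have q5 := add_four_mul_ne n53 y4 y0
    obtain ⟨i0, e0⟩ := hex (β1 + 4 * y0) (fun hx => z1 (by linarith)) r1 r2
    obtain ⟨i1, e1⟩ := hex (β1 + 4 * y0 - a.toInt) (fun hx => z1' (by linarith)) r3 r4
    obtain ⟨i2, e2⟩ := hex (β2 + 4 * y1) (fun hx => z2 (by linarith)) r5 r6
    obtain ⟨i3, e3⟩ := hex (β2 + 4 * y1 - c.toInt) (fun hx => z2' (by linarith)) r7 r8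
    obtain ⟨i4, e4⟩ := hex (β3 + 4 * y2) (fun hx => z3 (by linarith)) r9 r10
    obtain ⟨i5, e5⟩ := hex (β3 + 4 * y2 - b.toInt) (fun hx => z3' (by linarith)) r11 r12
    obtain ⟨i6, e6⟩ := hex (β4 + 4 * y3) (fun hx => z4 (by linarith)) r13 r14
    obtain ⟨i7, e7⟩ := hex (β4 + 4 * y3 - d.toInt) (fun hx => z4' (by linarith)) r15 r16
    obtain ⟨i8, e8⟩ := hex (β5 + 4 * y4) (fun hx => z5 (by linarith)) (by linarith) (by linarith)
    obtain ⟨j0, f0⟩ := hex _ (fun hx => q1 (by linarith)) s1 s2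
    obtain ⟨j1, f1⟩ := hex _ (fun hx => q2 (by linarith)) s3 s4
    obtain ⟨j2, f2⟩ := hex _ (fun hx => q3 (by linarith)) s5 s6
    obtain ⟨j3, f3⟩ := hex _ (fun hx => q4 (by linarith)) s7.1 s7.2
    obtain ⟨j4, f4⟩ := hex _ (fun hx => q5 (by linarith)) s8.1 s8.2
    refine ⟨Sum.elim ![i0, i1, i2, i3, i4, i5, i6, i7, i8] ![j0, j1, j2, j3, j4],
      mem_zeroSumTuples.2 ?_, e0, e2, e4, e6, e8⟩
    refine ⟨?_, ?_, ?_, ?_, ?_, ?_, ?_, ?_, ?_⟩ <;>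
      simp only [Sum.elim_inl, Sum.elim_inr, Matrix.cons_val] <;> linarith
  choose F hF hF0 hF1 hF2 hF3 hF4 using key
  calc m ^ 5 = (Finset.univ : Finset (Fin 5 → Fin m)).card := by simp
    _ ≤ _ := by
        refine Finset.card_le_card_of_injOn F (fun y _ => hF y) ?_
        intro y _ y' _ hyy
        have h0 := hF0 y; have h1 := hF1 y; have h2 := hF2 y; have h3 := hF3 y; have h4 := hF4 y
        rw [hyy] at h0 h1 h2 h3 h4
        rw [hF0] at h0
        rw [hF1] at h1
        rw [hF2] at h2
        rw [hF3] at h3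
        rw [hF4] at h4
        have hinj : ∀ {β : ℤ} {u v : ℕ}, β + 4 * (u : ℤ) = β + 4 * (v : ℤ) → v = u := by
          intro β u v h
          omega
        funext k
        apply Fin.ext
        fin_cases k
        exacts [hinj h0, hinj h1, hinj h2, hinj h3, hinj h4]

/-! ### The Gaussian signal -/

instance (p : ℕ) : IsProbabilityMeasure (signalLaw p) :=
  inferInstanceAs (IsProbabilityMeasure (Measure.pi fun _ => gaussianReal 0 (1 / (p : NNReal))))

theorem measurePreserving_eval_signalLaw {p : ℕ} (k : Freq p) :
    MeasurePreserving (Function.eval k) (signalLaw p) (gaussianReal 0 (1 / (p : NNReal))) :=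
  measurePreserving_eval (fun _ : Freq p => gaussianReal 0 (1 / (p : NNReal))) k

theorem integrable_pow_gaussianReal (v : NNReal) (n : ℕ) :
    Integrable (fun x => x ^ n) (gaussianReal 0 v) :=
  integrable_pow_of_integrable_exp_mul (X := fun x => x) one_ne_zero
    (integrable_exp_mul_gaussianReal 1) (integrable_exp_mul_gaussianReal (-1)) n

theorem integral_even_pow_gaussianReal {p : ℕ} (n : ℕ) :
    ∫ x, x ^ (2 * n) ∂(gaussianReal 0 (1 / (p : NNReal))) =
      (∫ x, x ^ (2 * n) ∂(gaussianReal 0 1)) * ((p : ℝ) ^ n)⁻¹ := by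
  have h : gaussianReal 0 (1 / (p : NNReal)) =
      (gaussianReal 0 1).map (fun x => (√(p : ℝ))⁻¹ * x) := by
    rw [gaussianReal_map_const_mul]
    congr 1
    · simp
    · ext
      simp [Real.sq_sqrt]
  rw [h, integral_map (by fun_prop) (by fun_prop), ← integral_mul_const]
  refine integral_congr_ae (ae_of_all _ fun x => ?_)
  simp only [mul_pow, inv_pow]
  rw [pow_mul (√(p : ℝ)), Real.sq_sqrt (by positivity)]
  ring

theorem integrable_coord_pow {p : ℕ} (k : Freq p) (n : ℕ) :
    Integrable (fun θ : Freq p → ℝ => θ k ^ n) (signalLaw p) :=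
  (measurePreserving_eval_signalLaw k).integrable_comp_of_integrable
    (integrable_pow_gaussianReal _ n)

theorem integral_coord_even_pow {p : ℕ} (k : Freq p) (n : ℕ) :
    ∫ θ, θ k ^ (2 * n) ∂(signalLaw p) =
      (∫ x, x ^ (2 * n) ∂(gaussianReal 0 1)) * ((p : ℝ) ^ n)⁻¹ := by
  rw [← integral_even_pow_gaussianReal, ← (measurePreserving_eval_signalLaw k).map_eq,
    integral_map (measurable_pi_apply k).aemeasurable (by fun_prop)]

theorem measureReal_coord_sq_gt_le {p : ℕ} (hp : 0 < p) (k : Freq p) {x : ℝ} (hx : 0 ≤ x) :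
    (signalLaw p).real {θ | x / p < θ k ^ 2} ≤ 2 * Real.exp (-(x / 2)) := by
  have hp' : (0 : ℝ) < p := by exact_mod_cast hp
  have hG : HasSubgaussianMGF (fun x => x) (1 / (p : NNReal)) (gaussianReal 0 (1 / (p : NNReal))) :=
    ⟨integrable_exp_mul_gaussianReal, fun t => by rw [mgf_fun_id_gaussianReal]; simp⟩
  have hS : HasSubgaussianMGF (fun θ : Freq p → ℝ => θ k) (1 / (p : NNReal)) (signalLaw p) := by
    rw [← (measurePreserving_eval_signalLaw k).map_eq] at hG
    exact HasSubgaussianMGF.of_map (measurePreserving_eval_signalLaw k).measurable.aemeasurable hG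
  have h1 := hS.measure_ge_le (Real.sqrt_nonneg (x / p))
  have h2 := hS.neg.measure_ge_le (Real.sqrt_nonneg (x / p))
  have he : -√(x / p) ^ 2 / (2 * ((1 / (p : NNReal) : NNReal) : ℝ)) = -(x / 2) := by
    rw [Real.sq_sqrt (by positivity)]
    push_cast
    field_simp
  rw [he] at h1 h2
  calc _ ≤ (signalLaw p).real ({θ | √(x / p) ≤ θ k} ∪
          {θ | √(x / p) ≤ (-fun θ : Freq p → ℝ => θ k) θ}) := by
        refine measureReal_mono fun θ hθ => ?_
        have h : √(x / p) ≤ |θ k| := by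
          rw [← Real.sqrt_sq_eq_abs]
          exact Real.sqrt_le_sqrt (le_of_lt hθ)
        rcases le_abs.1 h with h | h
        · exact Or.inl h
        · exact Or.inr h
    _ ≤ _ := measureReal_union_le _ _
    _ ≤ _ := by linarith

/-- The Gaussian density is at most `√p`, and the event is an interval of length `2 * ε / √p`. -/
theorem measureReal_coord_sq_lt_le {p : ℕ} (hp : 0 < p) (k : Freq p) {ε : ℝ} (hε : 0 ≤ ε) :
    (signalLaw p).real {θ | θ k ^ 2 < ε ^ 2 / p} ≤ 2 * ε := by
  have hp' : (0 : ℝ) < p := by exact_mod_cast hp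
  have hv : (1 / (p : NNReal)) ≠ 0 := by positivity
  have hs : MeasurableSet {x : ℝ | x ^ 2 < ε ^ 2 / p} :=
    measurableSet_lt (by fun_prop) measurable_const
  have h1 : (signalLaw p) {θ | θ k ^ 2 < ε ^ 2 / p} =
      gaussianReal 0 (1 / (p : NNReal)) {x | x ^ 2 < ε ^ 2 / p} :=
    (measurePreserving_eval_signalLaw k).measure_preimage hs.nullMeasurableSet
  have hpdf : ∀ x, gaussianPDF 0 (1 / (p : NNReal)) x ≤ ENNReal.ofReal (√p) := fun x => by
    refine ENNReal.ofReal_le_ofReal ?_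
    rw [gaussianPDFReal]
    have hexp : Real.exp (-(x - 0) ^ 2 / (2 * ((1 / (p : NNReal) : NNReal) : ℝ))) ≤ 1 :=
      Real.exp_le_one_iff.2 (div_nonpos_of_nonpos_of_nonneg (by nlinarith [sq_nonneg (x - 0)])
        (by positivity))
    have hsq : (√(2 * Real.pi * ((1 / (p : NNReal) : NNReal) : ℝ)))⁻¹ ≤ √p := by
      rw [← Real.sqrt_inv]
      refine Real.sqrt_le_sqrt ?_
      push_cast
      rw [mul_inv, one_div, inv_inv]
      refine mul_le_of_le_one_left hp'.le (inv_le_one_of_one_le₀ ?_)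
      nlinarith [Real.pi_gt_three]
    calc _ ≤ √(p : ℝ) * 1 := mul_le_mul hsq hexp (Real.exp_pos _).le (Real.sqrt_nonneg _)
      _ = _ := mul_one _
  have h2 : gaussianReal 0 (1 / (p : NNReal)) {x | x ^ 2 < ε ^ 2 / p} ≤ ENNReal.ofReal (2 * ε) := by
    rw [gaussianReal_apply 0 hv]
    calc _ ≤ ∫⁻ _ in {x : ℝ | x ^ 2 < ε ^ 2 / p}, ENNReal.ofReal (√p) :=
          lintegral_mono fun x => hpdf x
      _ = ENNReal.ofReal (√p) * volume {x : ℝ | x ^ 2 < ε ^ 2 / p} := setLIntegral_const _ _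
      _ ≤ ENNReal.ofReal (√p) * volume (Set.Ioo (-(ε / √p)) (ε / √p)) := by
          gcongr
          intro x hx
          have hx' : x ^ 2 < (ε / √p) ^ 2 := by
            rw [div_pow, Real.sq_sqrt hp'.le]; exact hx
          exact abs_lt.1 (abs_lt_of_sq_lt_sq hx' (by positivity))
      _ = ENNReal.ofReal (2 * ε) := by
          rw [Real.volume_Ioo, ← ENNReal.ofReal_mul (Real.sqrt_nonneg _)]
          congr 1
          have : √(p : ℝ) ≠ 0 := (Real.sqrt_pos.2 hp').ne'
          field_simp
          ring
  rw [Measure.real, h1]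
  exact ENNReal.toReal_le_of_le_ofReal (by positivity) h2

/-! ### Moments of monomials in the squared Fourier coefficients -/

/-- Bounding by the largest factor reduces mixed moments to moments of one coordinate, whatever
coincidences occur among the indices. -/
theorem prod_pow_le_sum_pow {ι : Type} [Fintype ι] [Nonempty ι] {f : ι → ℝ} (hf : ∀ i, 0 ≤ f i)
    (r : ℕ) : ∏ i, f i ^ r ≤ ∑ i, f i ^ (Fintype.card ι * r) := by
  obtain ⟨m, hm⟩ := Finite.exists_max f
  calc ∏ i, f i ^ r ≤ ∏ _i : ι, f m ^ r :=
        Finset.prod_le_prod (fun i _ => pow_nonneg (hf i) r)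
          fun i _ => pow_le_pow_left₀ (hf i) (hm i) r
    _ = f m ^ (Fintype.card ι * r) := by
        rw [Finset.prod_const, Finset.card_univ, ← pow_mul, mul_comm]
    _ ≤ _ := Finset.single_le_sum (f := fun i => f i ^ (Fintype.card ι * r))
        (fun i _ => pow_nonneg (hf i) _) (Finset.mem_univ m)

theorem norm_fourier_sq_pow_le {p : ℕ} (θ : Freq p → ℝ) (k : Freq p) (n : ℕ) :
    (‖fourier θ k‖ ^ 2) ^ n ≤ θ k ^ (2 * n) + θ (-k) ^ (2 * n) := by
  rw [norm_fourier_sq, pow_mul, pow_mul]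
  have h1 := sq_nonneg (θ k)
  have h2 := sq_nonneg (θ (-k))
  rcases le_total (θ k ^ 2) (θ (-k) ^ 2) with h | h
  · calc _ ≤ (θ (-k) ^ 2) ^ n := pow_le_pow_left₀ (by linarith) (by linarith) n
      _ ≤ _ := le_add_of_nonneg_left (pow_nonneg h1 n)
  · calc _ ≤ (θ k ^ 2) ^ n := pow_le_pow_left₀ (by linarith) (by linarith) n
      _ ≤ _ := le_add_of_nonneg_right (pow_nonneg h2 n)

theorem measurable_norm_fourier_sq {p : ℕ} (k : Freq p) :
    Measurable fun θ : Freq p → ℝ => ‖fourier θ k‖ ^ 2 := by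
  simp only [norm_fourier_sq]
  fun_prop

theorem card_slot : Fintype.card Slot = 14 := rfl

theorem prod_norm_fourier_sq_pow_le {p : ℕ} (θ : Freq p → ℝ) (z : Slot → Freq p) (r : ℕ) :
    ∏ l, (‖fourier θ (z l)‖ ^ 2) ^ r ≤
      ∑ l, (θ (z l) ^ (2 * (14 * r)) + θ (-z l) ^ (2 * (14 * r))) :=
  (prod_pow_le_sum_pow (fun _ => sq_nonneg _) r).trans
    (Finset.sum_le_sum fun _ _ => norm_fourier_sq_pow_le _ _ _)

theorem integrable_prod_norm_fourier_sq_pow {p : ℕ} (z : Slot → Freq p) (r : ℕ) :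
    Integrable (fun θ => ∏ l, (‖fourier θ (z l)‖ ^ 2) ^ r) (signalLaw p) := by
  refine Integrable.mono' (g := fun θ =>
    ∑ l, (θ (z l) ^ (2 * (14 * r)) + θ (-z l) ^ (2 * (14 * r)))) ?_ ?_ (ae_of_all _ fun θ => ?_)
  · exact integrable_finsetSum _ fun l _ =>
      (integrable_coord_pow _ _).add (integrable_coord_pow _ _)
  · exact (Finset.measurable_prod _ fun l _ =>
      (measurable_norm_fourier_sq (z l)).pow_const r).aestronglyMeasurable
  · rw [Real.norm_eq_abs, abs_of_nonneg (Finset.prod_nonneg fun l _ => by positivity)]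
    exact prod_norm_fourier_sq_pow_le θ z r

theorem integral_prod_norm_fourier_sq_pow_le {p : ℕ} (z : Slot → Freq p) (r : ℕ) :
    ∫ θ, ∏ l, (‖fourier θ (z l)‖ ^ 2) ^ r ∂(signalLaw p) ≤
      28 * (∫ x, x ^ (2 * (14 * r)) ∂(gaussianReal 0 1)) * ((p : ℝ) ^ (14 * r))⁻¹ := by
  have hi : ∀ l : Slot, Integrable (fun θ : Freq p → ℝ =>
      θ (z l) ^ (2 * (14 * r)) + θ (-z l) ^ (2 * (14 * r))) (signalLaw p) := fun l =>
    (integrable_coord_pow _ _).add (integrable_coord_pow _ _)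
  calc _ ≤ ∫ θ, ∑ l, (θ (z l) ^ (2 * (14 * r)) + θ (-z l) ^ (2 * (14 * r))) ∂(signalLaw p) :=
        integral_mono (integrable_prod_norm_fourier_sq_pow z r)
          (integrable_finsetSum _ fun l _ => hi l) fun θ => prod_norm_fourier_sq_pow_le θ z r
    _ = _ := by
        rw [integral_finsetSum _ fun l _ => hi l]
        simp only [integral_add (integrable_coord_pow _ _) (integrable_coord_pow _ _),
          integral_coord_even_pow]
        rw [Finset.sum_const, Finset.card_univ, card_slot, nsmul_eq_mul]
        push_cast
        ring

theorem le_integral_prod_norm_fourier_sq {p : ℕ} (hp : 0 < p) (z : Slot → Freq p) :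
    (1 / 2) * ((1 / 56) ^ 2 / 2) ^ 14 * ((p : ℝ) ^ 14)⁻¹ ≤
      ∫ θ, ∏ l, ‖fourier θ (z l)‖ ^ 2 ∂(signalLaw p) := by
  have hp' : (0 : ℝ) < p := by exact_mod_cast hp
  -- The value `1 / 56` makes the union bound over fourteen slots equal `14 * 2 / 56 = 1 / 2`. No
  -- independence is used.
  set A : Set (Freq p → ℝ) := ⋃ l : Slot, {θ | θ (z l) ^ 2 < (1 / 56 : ℝ) ^ 2 / p} with hA
  have hAm : MeasurableSet A := MeasurableSet.iUnion fun l =>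
    measurableSet_lt ((measurable_pi_apply _).pow_const 2) measurable_const
  have hAle : (signalLaw p).real A ≤ 1 / 2 := by
    calc _ ≤ ∑ l : Slot, (signalLaw p).real {θ | θ (z l) ^ 2 < (1 / 56 : ℝ) ^ 2 / p} :=
          measureReal_iUnion_fintype_le _
      _ ≤ ∑ _l : Slot, 2 * (1 / 56 : ℝ) :=
          Finset.sum_le_sum fun l _ => measureReal_coord_sq_lt_le hp _ (by norm_num)
      _ = 1 / 2 := by
          rw [Finset.sum_const, Finset.card_univ, card_slot]
          norm_num
  have hAc : 1 / 2 ≤ (signalLaw p).real Aᶜ := by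
    rw [probReal_compl_eq_one_sub hAm]
    linarith
  set κ : ℝ := (((1 / 56) ^ 2 / 2) / p) ^ 14 with hκ
  have hint : Integrable (fun θ => ∏ l, ‖fourier θ (z l)‖ ^ 2) (signalLaw p) := by
    simpa using integrable_prod_norm_fourier_sq_pow z 1
  calc _ = 1 / 2 * κ := by rw [hκ, div_pow _ (p : ℝ)]; ring
    _ ≤ (signalLaw p).real Aᶜ * κ := by gcongr
    _ = ∫ θ, Aᶜ.indicator (fun _ => κ) θ ∂(signalLaw p) := by
        rw [integral_indicator_const _ hAm.compl, smul_eq_mul]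
    _ ≤ _ := by
        refine integral_mono ((integrable_const κ).indicator hAm.compl) hint fun θ => ?_
        by_cases hθ : θ ∈ A
        · rw [Set.indicator_of_notMem (by simpa using hθ)]
          exact Finset.prod_nonneg fun l _ => by positivity
        · rw [Set.indicator_of_mem (by simpa using hθ)]
          have hθ' : ∀ l, (1 / 56 : ℝ) ^ 2 / p ≤ θ (z l) ^ 2 := fun l => by
            by_contra h
            exact hθ (Set.mem_iUnion.2 ⟨l, not_le.1 h⟩)
          calc κ = ∏ _l : Slot, (((1 / 56 : ℝ) ^ 2 / 2) / p) := by
                rw [Finset.prod_const, Finset.card_univ, card_slot]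
            _ ≤ _ := by
                refine Finset.prod_le_prod (fun _ _ => by positivity) fun l _ => ?_
                rw [norm_fourier_sq]
                have h1 := hθ' l
                have h2 := sq_nonneg (θ (-z l))
                rw [div_right_comm]
                linarith

/-! ### Moments of the random coefficients -/

theorem integrable_sCoeff {p : ℕ} (a b c d : Freq p) :
    Integrable (fun θ => sCoeff θ a b c d) (signalLaw p) := by
  simp only [sCoeff_eq_sum]
  exact integrable_finsetSum _ fun z _ => by simpa using integrable_prod_norm_fourier_sq_pow z 1

theorem meanS_eq_sum {p : ℕ} (a b c d : Freq p) :
    meanS a b c d =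
      ∑ z ∈ zeroSumTuples a b c d, ∫ θ, ∏ l, ‖fourier θ (z l)‖ ^ 2 ∂(signalLaw p) := by
  simp only [meanS, sCoeff_eq_sum]
  exact integral_finsetSum _ fun z _ => by simpa using integrable_prod_norm_fourier_sq_pow z 1

theorem integral_even_pow_nonneg (n : ℕ) : 0 ≤ ∫ x, x ^ (2 * n) ∂(gaussianReal 0 1) :=
  integral_nonneg fun x => (even_two_mul n).pow_nonneg x

theorem meanS_le {p : ℕ} (hp : 0 < p) (a b c d : Freq p) :
    meanS a b c d ≤ 28 * (∫ x, x ^ (2 * 14) ∂(gaussianReal 0 1)) * ((p : ℝ) ^ 9)⁻¹ := by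
  have hp' : (0 : ℝ) < p := by exact_mod_cast hp
  have h0 := integral_even_pow_nonneg 14
  set C := 28 * (∫ x, x ^ (2 * 14) ∂(gaussianReal 0 1)) with hC
  rw [meanS_eq_sum]
  calc _ ≤ ∑ _z ∈ zeroSumTuples a b c d, C * ((p : ℝ) ^ 14)⁻¹ :=
        Finset.sum_le_sum fun z _ => by simpa using integral_prod_norm_fourier_sq_pow_le z 1
    _ = (zeroSumTuples a b c d).card * (C * ((p : ℝ) ^ 14)⁻¹) := by
        rw [Finset.sum_const, nsmul_eq_mul]
    _ ≤ (p : ℝ) ^ 5 * (C * ((p : ℝ) ^ 14)⁻¹) := by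
        gcongr
        exact_mod_cast card_zeroSumTuples_le a b c d
    _ = _ := by
        field_simp

theorem le_meanS {p : ℕ} (hp : 1024 ≤ p) (a b c d : Freq p) :
    (1 / 512) ^ 5 * ((1 / 2) * ((1 / 56) ^ 2 / 2) ^ 14) * ((p : ℝ) ^ 9)⁻¹ ≤ meanS a b c d := by
  have hp' : (0 : ℝ) < p := by
    have : 0 < p := by omega
    exact_mod_cast this
  set κ : ℝ := (1 / 2) * ((1 / 56) ^ 2 / 2) ^ 14 with hκ
  have hcard : ((p : ℝ) / 512) ^ 5 ≤ (zeroSumTuples a b c d).card := by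
    have h1 : p ≤ 512 * (p / 2 / 128) := by omega
    have h2 : (p : ℝ) ≤ 512 * ((p / 2 / 128 : ℕ) : ℝ) := by exact_mod_cast h1
    have h3 : (((p / 2 / 128 : ℕ) : ℝ)) ^ 5 ≤ (zeroSumTuples a b c d).card := by
      exact_mod_cast le_card_zeroSumTuples (by omega) a b c d
    refine le_trans (pow_le_pow_left₀ (by positivity) ?_ 5) h3
    linarith
  rw [meanS_eq_sum]
  calc _ = ((p : ℝ) / 512) ^ 5 * (κ * ((p : ℝ) ^ 14)⁻¹) := by
        field_simp
    _ ≤ (zeroSumTuples a b c d).card * (κ * ((p : ℝ) ^ 14)⁻¹) := by gcongr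
    _ = ∑ _z ∈ zeroSumTuples a b c d, κ * ((p : ℝ) ^ 14)⁻¹ := by
        rw [Finset.sum_const, nsmul_eq_mul]
    _ ≤ _ := Finset.sum_le_sum fun z _ => le_integral_prod_norm_fourier_sq (by omega) z

theorem sq_sCoeff_le {p : ℕ} (θ : Freq p → ℝ) (a b c d : Freq p) :
    sCoeff θ a b c d ^ 2 ≤
      (p : ℝ) ^ 5 * ∑ z ∈ zeroSumTuples a b c d, ∏ l, (‖fourier θ (z l)‖ ^ 2) ^ 2 := by
  rw [sCoeff_eq_sum]
  refine sq_sum_le_card_mul_sum_sq.trans ?_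
  simp only [Finset.prod_pow]
  gcongr
  exact_mod_cast card_zeroSumTuples_le a b c d

theorem integrable_sq_sCoeff {p : ℕ} (a b c d : Freq p) :
    Integrable (fun θ => sCoeff θ a b c d ^ 2) (signalLaw p) := by
  refine Integrable.mono' (g := fun θ =>
    (p : ℝ) ^ 5 * ∑ z ∈ zeroSumTuples a b c d, ∏ l, (‖fourier θ (z l)‖ ^ 2) ^ 2) ?_ ?_
    (ae_of_all _ fun θ => ?_)
  · exact (integrable_finsetSum _ fun z _ =>
      integrable_prod_norm_fourier_sq_pow z 2).const_mul _
  · exact (integrable_sCoeff a b c d).aestronglyMeasurable.pow 2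
  · rw [Real.norm_eq_abs, abs_of_nonneg (sq_nonneg _)]
    exact sq_sCoeff_le θ a b c d

theorem integral_sq_sCoeff_le {p : ℕ} (hp : 0 < p) (a b c d : Freq p) :
    ∫ θ, sCoeff θ a b c d ^ 2 ∂(signalLaw p) ≤
      28 * (∫ x, x ^ (2 * 28) ∂(gaussianReal 0 1)) * ((p : ℝ) ^ 18)⁻¹ := by
  have hp' : (0 : ℝ) < p := by exact_mod_cast hp
  have h0 := integral_even_pow_nonneg 28
  set C := 28 * (∫ x, x ^ (2 * 28) ∂(gaussianReal 0 1)) with hC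
  have hi : ∀ z : Slot → Freq p, Integrable (fun θ => ∏ l, (‖fourier θ (z l)‖ ^ 2) ^ 2)
    (signalLaw p) := fun z => integrable_prod_norm_fourier_sq_pow z 2
  calc _ ≤ ∫ θ, (p : ℝ) ^ 5 * ∑ z ∈ zeroSumTuples a b c d, ∏ l, (‖fourier θ (z l)‖ ^ 2) ^ 2
          ∂(signalLaw p) :=
        integral_mono (integrable_sq_sCoeff a b c d)
          ((integrable_finsetSum _ fun z _ => hi z).const_mul _) fun θ => sq_sCoeff_le θ a b c d
    _ = (p : ℝ) ^ 5 * ∑ z ∈ zeroSumTuples a b c d,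
          ∫ θ, ∏ l, (‖fourier θ (z l)‖ ^ 2) ^ 2 ∂(signalLaw p) := by
        rw [integral_const_mul, integral_finsetSum _ fun z _ => hi z]
    _ ≤ (p : ℝ) ^ 5 * ∑ _z ∈ zeroSumTuples a b c d, C * ((p : ℝ) ^ 28)⁻¹ := by
        gcongr with z _
        simpa using integral_prod_norm_fourier_sq_pow_le z 2
    _ = (p : ℝ) ^ 5 * ((zeroSumTuples a b c d).card * (C * ((p : ℝ) ^ 28)⁻¹)) := by
        rw [Finset.sum_const, nsmul_eq_mul]
    _ ≤ (p : ℝ) ^ 5 * ((p : ℝ) ^ 5 * (C * ((p : ℝ) ^ 28)⁻¹)) := by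
        gcongr
        exact_mod_cast card_zeroSumTuples_le a b c d
    _ = _ := by
        field_simp

/-! ### Truncation and concentration of the random coefficients -/

theorem sCoeff_nonneg {p : ℕ} (θ : Freq p → ℝ) (a b c d : Freq p) : 0 ≤ sCoeff θ a b c d := by
  rw [sCoeff_eq_sum]
  exact Finset.sum_nonneg fun z _ => Finset.prod_nonneg fun l _ => by positivity

/-- Every monomial is nondecreasing in the squared coordinates, so truncation can only lower
`s_abcd`. -/
theorem sCoeff_mono {p : ℕ} {θ θ' : Freq p → ℝ} (h : ∀ k, θ k ^ 2 ≤ θ' k ^ 2) (a b c d : Freq p) :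
    sCoeff θ a b c d ≤ sCoeff θ' a b c d := by
  simp only [sCoeff_eq_sum, norm_fourier_sq]
  refine Finset.sum_le_sum fun z _ => Finset.prod_le_prod (fun l _ => by positivity) fun l _ => ?_
  linarith [h (z l), h (-z l)]

theorem norm_fourier_sq_le {p : ℕ} {θ : Freq p → ℝ} {R : ℝ} (h : ∀ k, θ k ^ 2 ≤ R) (k : Freq p) :
    ‖fourier θ k‖ ^ 2 ≤ R := by
  rw [norm_fourier_sq]
  linarith [h k, h (-k)]

theorem prod_norm_fourier_sq_le {p : ℕ} {θ : Freq p → ℝ} {R : ℝ} (h : ∀ k, θ k ^ 2 ≤ R)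
    (z : Slot → Freq p) : ∏ l, ‖fourier θ (z l)‖ ^ 2 ≤ R ^ 14 := by
  calc _ ≤ ∏ _l : Slot, R :=
        Finset.prod_le_prod (fun _ _ => by positivity) fun l _ => norm_fourier_sq_le h (z l)
    _ = _ := by rw [Finset.prod_const, Finset.card_univ, card_slot]

theorem sCoeff_le {p : ℕ} {θ : Freq p → ℝ} {R : ℝ} (hR : 0 ≤ R) (h : ∀ k, θ k ^ 2 ≤ R)
    (a b c d : Freq p) : sCoeff θ a b c d ≤ (p : ℝ) ^ 5 * R ^ 14 := by
  have hR14 : 0 ≤ R ^ 14 := pow_nonneg hR 14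
  rw [sCoeff_eq_sum]
  calc _ ≤ ∑ _z ∈ zeroSumTuples a b c d, R ^ 14 :=
        Finset.sum_le_sum fun z _ => prod_norm_fourier_sq_le h z
    _ = (zeroSumTuples a b c d).card * R ^ 14 := by rw [Finset.sum_const, nsmul_eq_mul]
    _ ≤ _ := by
        gcongr
        exact_mod_cast card_zeroSumTuples_le a b c d

/-- Coordinate `m` enters only through the squared moduli at `m` and `-m`. Two values in each of
fourteen slots, with at most `p ^ 4` tuples apiece, give the factor 28. -/
theorem abs_sCoeff_sub_le {p : ℕ} {θ θ' : Freq p → ℝ} {R : ℝ} (hR : 0 ≤ R)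
    (hθ : ∀ k, θ k ^ 2 ≤ R) (hθ' : ∀ k, θ' k ^ 2 ≤ R) {m : Freq p} (hm : ∀ k, k ≠ m → θ' k = θ k)
    (a b c d : Freq p) :
    |sCoeff θ' a b c d - sCoeff θ a b c d| ≤ 28 * (p : ℝ) ^ 4 * R ^ 14 := by
  have hR14 : 0 ≤ R ^ 14 := pow_nonneg hR 14
  have hind : ∀ (z : Slot → Freq p) (l : Slot), 0 ≤
      (if z l = m then R ^ 14 else 0) + (if z l = -m then R ^ 14 else 0) := fun z l =>
    add_nonneg (by split_ifs <;> simp [hR14]) (by split_ifs <;> simp [hR14])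
  have hterm : ∀ z : Slot → Freq p,
      |∏ l, ‖fourier θ' (z l)‖ ^ 2 - ∏ l, ‖fourier θ (z l)‖ ^ 2| ≤
        ∑ l, ((if z l = m then R ^ 14 else 0) + (if z l = -m then R ^ 14 else 0)) := by
    intro z
    by_cases hz : ∃ l, z l = m ∨ z l = -m
    · obtain ⟨l, hl⟩ := hz
      have h1 : R ^ 14 ≤ (if z l = m then R ^ 14 else 0) + (if z l = -m then R ^ 14 else 0) := by
        rcases hl with h | h
        · rw [if_pos h]
          exact le_add_of_nonneg_right (by split_ifs <;> simp [hR14])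
        · rw [if_pos h]
          exact le_add_of_nonneg_left (by split_ifs <;> simp [hR14])
      refine le_trans ?_ (h1.trans (Finset.single_le_sum
        (f := fun l => (if z l = m then R ^ 14 else 0) + (if z l = -m then R ^ 14 else 0))
        (fun l _ => hind z l) (Finset.mem_univ l)))
      have h2 := prod_norm_fourier_sq_le hθ z
      have h3 := prod_norm_fourier_sq_le hθ' z
      have h4 : 0 ≤ ∏ l, ‖fourier θ (z l)‖ ^ 2 := Finset.prod_nonneg fun l _ => by positivity
      have h5 : 0 ≤ ∏ l, ‖fourier θ' (z l)‖ ^ 2 := Finset.prod_nonneg fun l _ => by positivity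
      rw [abs_le]
      constructor <;> linarith
    · push Not at hz
      have h : ∏ l, ‖fourier θ' (z l)‖ ^ 2 = ∏ l, ‖fourier θ (z l)‖ ^ 2 := by
        refine Finset.prod_congr rfl fun l _ => ?_
        rw [norm_fourier_sq, norm_fourier_sq, hm _ (hz l).1, hm (-z l) fun h => (hz l).2 ?_]
        rw [← h, Freq.neg_neg]
      rw [h, sub_self, abs_zero]
      exact Finset.sum_nonneg fun l _ => hind z l
  have hcount : ∀ (l : Slot) (k : Freq p),
      ∑ z ∈ zeroSumTuples a b c d, (if z l = k then R ^ 14 else 0) ≤ (p : ℝ) ^ 4 * R ^ 14 := by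
    intro l k
    rw [← Finset.sum_filter, Finset.sum_const, nsmul_eq_mul]
    gcongr
    exact_mod_cast card_filter_zeroSumTuples_le a b c d l k
  rw [sCoeff_eq_sum, sCoeff_eq_sum, ← Finset.sum_sub_distrib]
  calc _ ≤ ∑ z ∈ zeroSumTuples a b c d,
          |∏ l, ‖fourier θ' (z l)‖ ^ 2 - ∏ l, ‖fourier θ (z l)‖ ^ 2| := Finset.abs_sum_le_sum_abs _ _
    _ ≤ ∑ z ∈ zeroSumTuples a b c d,
          ∑ l, ((if z l = m then R ^ 14 else 0) + (if z l = -m then R ^ 14 else 0)) :=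
        Finset.sum_le_sum fun z _ => hterm z
    _ = ∑ l : Slot, (∑ z ∈ zeroSumTuples a b c d, (if z l = m then R ^ 14 else 0) +
          ∑ z ∈ zeroSumTuples a b c d, (if z l = -m then R ^ 14 else 0)) := by
        rw [Finset.sum_comm]
        simp only [Finset.sum_add_distrib]
    _ ≤ ∑ _l : Slot, ((p : ℝ) ^ 4 * R ^ 14 + (p : ℝ) ^ 4 * R ^ 14) :=
        Finset.sum_le_sum fun l _ => add_le_add (hcount l m) (hcount l (-m))
    _ = _ := by
        rw [Finset.sum_const, Finset.card_univ, card_slot, nsmul_eq_mul]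
        push_cast
        ring

/-- Coordinatewise truncation at level `√R`. -/
def clip {p : ℕ} (R : ℝ) (θ : Freq p → ℝ) : Freq p → ℝ := fun k => max (-√R) (min (√R) (θ k))

theorem clip_sq_le {p : ℕ} {R : ℝ} (hR : 0 ≤ R) (θ : Freq p → ℝ) (k : Freq p) :
    clip R θ k ^ 2 ≤ R := by
  have h := Real.sqrt_nonneg R
  refine (Real.sq_le hR).2 ⟨le_max_left _ _, max_le (by linarith) (min_le_left _ _)⟩

theorem clip_sq_le_sq {p : ℕ} (R : ℝ) (θ : Freq p → ℝ) (k : Freq p) :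
    clip R θ k ^ 2 ≤ θ k ^ 2 := by
  have h := Real.sqrt_nonneg R
  rw [sq_le_sq, clip]
  rcases le_total 0 (θ k) with h0 | h0
  · rw [abs_of_nonneg h0, abs_le]
    constructor
    · exact le_max_of_le_right (le_min (by linarith) (by linarith))
    · exact max_le (by linarith) (min_le_right _ _)
  · rw [abs_of_nonpos h0, abs_le]
    constructor
    · rw [neg_neg]
      exact le_max_of_le_right (le_min (by linarith) le_rfl)
    · exact max_le (by linarith) ((min_le_right _ _).trans (by linarith))

theorem clip_eq_self {p : ℕ} {R : ℝ} {θ : Freq p → ℝ} (h : ∀ k, θ k ^ 2 ≤ R) : clip R θ = θ := by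
  funext k
  obtain ⟨h1, h2⟩ := abs_le.1 (Real.abs_le_sqrt (h k))
  rw [clip, min_eq_right h2, max_eq_right h1]

theorem measurable_sCoeff_clip {p : ℕ} (R : ℝ) (a b c d : Freq p) :
    Measurable fun θ : Freq p → ℝ => sCoeff (clip R θ) a b c d := by
  simp only [sCoeff_eq_sum, norm_fourier_sq, clip]
  fun_prop

/-- Clipping rather than conditioning keeps the product measure, and makes the difference bound
valid at every point. -/
theorem measureReal_abs_sCoeff_clip_sub_ge_le {p : ℕ} {R : ℝ} (hR : 0 ≤ R) (a b c d : Freq p)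
    {t : ℝ} (ht : 0 ≤ t) :
    (signalLaw p).real {θ | t ≤ |sCoeff (clip R θ) a b c d -
        ∫ φ, sCoeff (clip R φ) a b c d ∂(signalLaw p)|} ≤
      2 * Real.exp (-t ^ 2 / (2 * (p * (28 * (p : ℝ) ^ 4 * R ^ 14) ^ 2))) := by
  have h := measureReal_abs_sub_ge_le_of_bounded_difference (ι := Freq p)
    (μ := gaussianReal 0 (1 / (p : NNReal))) (c := Real.toNNReal (28 * (p : ℝ) ^ 4 * R ^ 14))
    (f := fun θ => sCoeff (clip R θ) a b c d) (B := (p : ℝ) ^ 5 * R ^ 14)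
    (measurable_sCoeff_clip R a b c d)
    (fun θ => by
      rw [abs_of_nonneg (sCoeff_nonneg _ _ _ _ _)]
      exact sCoeff_le hR (clip_sq_le hR θ) a b c d)
    (fun θ m v => by
      rw [Real.coe_toNNReal _ (by positivity)]
      exact abs_sCoeff_sub_le hR (clip_sq_le hR θ) (clip_sq_le hR _)
        (m := m) (fun k hk => by simp [clip, hk]) a b c d) ht
  refine h.trans ?_
  rw [Real.coe_toNNReal _ (by positivity)]
  -- For `R = 0` both denominators vanish and division by zero makes both exponents zero.
  rcases hR.eq_or_lt with rfl | hR'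
  · simp
  have hcard : 0 < Fintype.card (Freq p) := Fintype.card_pos_iff.2 ⟨a⟩
  have hp : 0 < p := hcard.trans_le (card_freq_le p)
  have h1 : (0 : ℝ) < Fintype.card (Freq p) := by exact_mod_cast hcard
  have h2 : (Fintype.card (Freq p) : ℝ) ≤ p := by exact_mod_cast card_freq_le p
  have hp' : (0 : ℝ) < p := by exact_mod_cast hp
  rw [neg_div, neg_div]
  gcongr

theorem integrable_sCoeff_clip {p : ℕ} (R : ℝ) (a b c d : Freq p) :
    Integrable (fun θ : Freq p → ℝ => sCoeff (clip R θ) a b c d) (signalLaw p) :=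
  (integrable_sCoeff a b c d).mono' (measurable_sCoeff_clip R a b c d).aestronglyMeasurable
    (ae_of_all _ fun θ => by
      rw [Real.norm_eq_abs, abs_of_nonneg (sCoeff_nonneg _ _ _ _ _)]
      exact sCoeff_mono (clip_sq_le_sq R θ) a b c d)

theorem integral_sCoeff_clip_le_meanS {p : ℕ} (R : ℝ) (a b c d : Freq p) :
    ∫ θ, sCoeff (clip R θ) a b c d ∂(signalLaw p) ≤ meanS a b c d :=
  integral_mono (integrable_sCoeff_clip R a b c d) (integrable_sCoeff a b c d)
    fun θ => sCoeff_mono (clip_sq_le_sq R θ) a b c d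

/-- The difference vanishes unless some coordinate is truncated. On that event it is at most `s ≤ (δ
* s ^ 2 + δ⁻¹) / 2`, which trades the second moment against the probability of truncation. -/
theorem meanS_sub_integral_sCoeff_clip_le {p : ℕ} (hp : 0 < p) {R δ : ℝ} (hδ : 0 < δ)
    (a b c d : Freq p) :
    meanS a b c d - ∫ θ, sCoeff (clip R θ) a b c d ∂(signalLaw p) ≤
      (δ * (28 * (∫ x, x ^ (2 * 28) ∂(gaussianReal 0 1)) * ((p : ℝ) ^ 18)⁻¹) +
        δ⁻¹ * (signalLaw p).real {θ | ∃ k, R < θ k ^ 2}) / 2 := by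
  set A : Set (Freq p → ℝ) := {θ | ∃ k, R < θ k ^ 2} with hA
  have hAm : MeasurableSet A := by
    have : A = ⋃ k, {θ | R < θ k ^ 2} := by ext; simp [hA]
    rw [this]
    exact MeasurableSet.iUnion fun k =>
      measurableSet_lt measurable_const ((measurable_pi_apply k).pow_const 2)
  have hclip := integrable_sCoeff_clip R a b c d
  have hs2 := integrable_sq_sCoeff a b c d
  have hi : Integrable (A.indicator fun _ => (1 : ℝ)) (signalLaw p) :=
    (integrable_const 1).indicator hAm
  have hpt : ∀ θ : Freq p → ℝ, sCoeff θ a b c d - sCoeff (clip R θ) a b c d ≤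
      (δ * sCoeff θ a b c d ^ 2 + δ⁻¹ * A.indicator (fun _ => (1 : ℝ)) θ) / 2 := by
    intro θ
    by_cases hθ : θ ∈ A
    · rw [Set.indicator_of_mem hθ]
      have h1 := sCoeff_nonneg (clip R θ) a b c d
      have h2 : 0 ≤ (√δ * sCoeff θ a b c d - (√δ)⁻¹) ^ 2 := sq_nonneg _
      have h3 : √δ ^ 2 = δ := Real.sq_sqrt hδ.le
      have h4 : √δ * (√δ)⁻¹ = 1 := mul_inv_cancel₀ (Real.sqrt_pos.2 hδ).ne'
      have h5 : (√δ)⁻¹ ^ 2 = δ⁻¹ := by rw [inv_pow, h3]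
      have h6 : (√δ * sCoeff θ a b c d - (√δ)⁻¹) ^ 2 =
          δ * sCoeff θ a b c d ^ 2 - 2 * sCoeff θ a b c d + δ⁻¹ := by
        rw [← h5]
        linear_combination sCoeff θ a b c d ^ 2 * h3 - 2 * sCoeff θ a b c d * h4
      linarith
    · rw [Set.indicator_of_notMem hθ, clip_eq_self fun k => not_lt.1 fun h => hθ ⟨k, h⟩, sub_self]
      positivity
  have hcalc : ∫ θ, (δ * sCoeff θ a b c d ^ 2 + δ⁻¹ * A.indicator (fun _ => (1 : ℝ)) θ) / 2
      ∂(signalLaw p) = (δ * ∫ θ, sCoeff θ a b c d ^ 2 ∂(signalLaw p) +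
        δ⁻¹ * (signalLaw p).real A) / 2 := by
    rw [integral_div, integral_add (hs2.const_mul δ) (hi.const_mul δ⁻¹), integral_const_mul,
      integral_const_mul, integral_indicator_const _ hAm, smul_eq_mul, mul_one]
  rw [meanS, ← integral_sub (integrable_sCoeff a b c d) hclip]
  refine (integral_mono ((integrable_sCoeff a b c d).sub hclip)
    (((hs2.const_mul δ).add (hi.const_mul δ⁻¹)).div_const 2) hpt).trans (hcalc.le.trans ?_)
  have := integral_sq_sCoeff_le hp a b c d
  gcongr

theorem measureReal_exists_coord_sq_gt_le {p : ℕ} (hp : 0 < p) {x : ℝ} (hx : 0 ≤ x) :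
    (signalLaw p).real {θ | ∃ k, x / p < θ k ^ 2} ≤ p * (2 * Real.exp (-(x / 2))) := by
  have : {θ : Freq p → ℝ | ∃ k, x / p < θ k ^ 2} = ⋃ k, {θ | x / p < θ k ^ 2} := by ext; simp
  rw [this]
  calc _ ≤ ∑ k, (signalLaw p).real {θ | x / p < θ k ^ 2} := measureReal_iUnion_fintype_le _
    _ ≤ ∑ _k : Freq p, 2 * Real.exp (-(x / 2)) :=
        Finset.sum_le_sum fun k _ => measureReal_coord_sq_gt_le hp k hx
    _ = Fintype.card (Freq p) * (2 * Real.exp (-(x / 2))) := by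
        rw [Finset.sum_const, Finset.card_univ, nsmul_eq_mul]
    _ ≤ _ := by
        gcongr
        exact card_freq_le p

/-! ### The error of the corrected network matrix -/

/-- Corrected entries have relative error at most `τ` and total squared mass at most `x ^ 4`.
Uncorrected entries have relative error exactly one, but the constraint `a = -b` or `c = -d` removes
a free index, leaving mass `x ^ 4 / p` for each of the two cases. -/
theorem sqrt_error_le {p : ℕ} (hp : 0 < p) {θ : Freq p → ℝ} {x τ : ℝ} (hx : 0 ≤ x)
    (hθ : ∀ k, θ k ^ 2 ≤ x / p) (hpos : ∀ a b c d : Freq p, 0 < meanS a b c d)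
    (hs : ∀ a b c d : Freq p, |sCoeff θ a b c d - meanS a b c d| ≤ τ * meanS a b c d) :
    √(∑ ab : Freq p × Freq p, ∑ cd : Freq p × Freq p,
        (correction ab.1 ab.2 cd.1 cd.2 * sCoeff θ ab.1 ab.2 cd.1 cd.2 - 1) ^ 2 *
          (‖fourier θ ab.1‖ ^ 2 * ‖fourier θ ab.2‖ ^ 2 *
            (‖fourier θ cd.1‖ ^ 2 * ‖fourier θ cd.2‖ ^ 2))) ≤
      √((τ * x ^ 2) ^ 2 + 2 * (x ^ 4 / p)) := by
  have hp' : (0 : ℝ) < p := by exact_mod_cast hp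
  refine Real.sqrt_le_sqrt ?_
  set X : Freq p → ℝ := fun k => ‖fourier θ k‖ ^ 2 with hX
  have hX0 : ∀ k, 0 ≤ X k := fun k => sq_nonneg _
  have hXle : ∀ k, X k ≤ x / p := norm_fourier_sq_le hθ
  have hcard : (Fintype.card (Freq p) : ℝ) ≤ p := by exact_mod_cast card_freq_le p
  have hS : ∑ k, X k ≤ x := by
    calc _ ≤ ∑ _k : Freq p, x / p := Finset.sum_le_sum fun k _ => hXle k
      _ = Fintype.card (Freq p) * (x / p) := by
        rw [Finset.sum_const, Finset.card_univ, nsmul_eq_mul]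
      _ ≤ p * (x / p) := by gcongr
      _ = x := by field_simp
  set u : Freq p × Freq p → ℝ := fun ab => X ab.1 * X ab.2 with hu
  set e : Freq p × Freq p → ℝ := fun ab => if ab.1 = -ab.2 then u ab else 0 with he
  have hu0 : ∀ ab, 0 ≤ u ab := fun ab => mul_nonneg (hX0 _) (hX0 _)
  have he0 : ∀ ab, 0 ≤ e ab := fun ab => by
    simp only [he]
    split_ifs
    exacts [hu0 _, le_rfl]
  have hU : ∑ ab, u ab ≤ x ^ 2 := by
    rw [Fintype.sum_prod_type, ← Finset.sum_mul_sum, ← sq]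
    exact pow_le_pow_left₀ (Finset.sum_nonneg fun k _ => hX0 k) hS 2
  have hE : ∑ ab, e ab ≤ x ^ 2 / p := by
    rw [Fintype.sum_prod_type_right]
    simp only [he, Finset.sum_ite_eq', Finset.mem_univ, if_true]
    calc _ ≤ ∑ _k : Freq p, (x / p) * (x / p) :=
          Finset.sum_le_sum fun k _ => mul_le_mul (hXle _) (hXle _) (hX0 _) (by positivity)
      _ = Fintype.card (Freq p) * ((x / p) * (x / p)) := by
        rw [Finset.sum_const, Finset.card_univ, nsmul_eq_mul]
      _ ≤ p * ((x / p) * (x / p)) := by gcongr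
      _ = x ^ 2 / p := by field_simp
  have hterm : ∀ ab cd : Freq p × Freq p,
      (correction ab.1 ab.2 cd.1 cd.2 * sCoeff θ ab.1 ab.2 cd.1 cd.2 - 1) ^ 2 * (u ab * u cd) ≤
        τ ^ 2 * (u ab * u cd) + (e ab * u cd + u ab * e cd) := by
    intro ab cd
    have h1 := mul_nonneg (hu0 ab) (hu0 cd)
    have h2 := mul_nonneg (he0 ab) (hu0 cd)
    have h3 := mul_nonneg (hu0 ab) (he0 cd)
    have h4 := mul_nonneg (sq_nonneg τ) h1
    by_cases hd : ab.1 = -ab.2 ∨ cd.1 = -cd.2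
    · rw [correction, if_pos hd, zero_mul, zero_sub, neg_one_sq, one_mul]
      rcases hd with hd | hd
      · have : e ab = u ab := if_pos hd
        rw [this]
        linarith
      · have : e cd = u cd := if_pos hd
        rw [this]
        linarith
    · rw [correction, if_neg hd]
      have hm := hpos ab.1 ab.2 cd.1 cd.2
      have h5 : (1 / meanS ab.1 ab.2 cd.1 cd.2 * sCoeff θ ab.1 ab.2 cd.1 cd.2 - 1) =
          (sCoeff θ ab.1 ab.2 cd.1 cd.2 - meanS ab.1 ab.2 cd.1 cd.2) /
            meanS ab.1 ab.2 cd.1 cd.2 := by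
        field_simp
      have h6 : |1 / meanS ab.1 ab.2 cd.1 cd.2 * sCoeff θ ab.1 ab.2 cd.1 cd.2 - 1| ≤ τ := by
        rw [h5, abs_div, abs_of_pos hm, div_le_iff₀ hm]
        exact hs _ _ _ _
      have h7 := mul_le_mul_of_nonneg_right (sq_le_sq' (abs_le.1 h6).1 (abs_le.1 h6).2) h1
      linarith
  calc _ ≤ ∑ ab, ∑ cd, (τ ^ 2 * (u ab * u cd) + (e ab * u cd + u ab * e cd)) :=
        Finset.sum_le_sum fun ab _ => Finset.sum_le_sum fun cd _ => hterm ab cd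
    _ = τ ^ 2 * ((∑ ab, u ab) * ∑ cd, u cd) +
          ((∑ ab, e ab) * (∑ cd, u cd) + (∑ ab, u ab) * ∑ cd, e cd) := by
        simp only [Finset.sum_add_distrib, ← Finset.mul_sum, Finset.sum_mul_sum]
    _ ≤ τ ^ 2 * (x ^ 2 * x ^ 2) + (x ^ 2 / p * x ^ 2 + x ^ 2 * (x ^ 2 / p)) := by
        have h1 : 0 ≤ ∑ ab, u ab := Finset.sum_nonneg fun _ _ => hu0 _
        have h2 : 0 ≤ ∑ ab, e ab := Finset.sum_nonneg fun _ _ => he0 _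
        gcongr
    _ = _ := by ring

/-- A lower bound for `p ^ 9 * meanS a b c d`. -/
def meanSLower : ℝ := (1 / 512) ^ 5 * ((1 / 2) * ((1 / 56) ^ 2 / 2) ^ 14)

theorem meanSLower_pos : 0 < meanSLower := by
  unfold meanSLower
  positivity

/-- An upper bound for `p ^ 18 * E[s ^ 2]`. -/
def secondMomentUpper : ℝ := 28 * (∫ x, x ^ (2 * 28) ∂(gaussianReal 0 1))

/-- The relative fluctuation of the coefficients `s_{abcd}`, at truncation level `x / p`. -/
def fluctuation (p x : ℝ) : ℝ :=
  ((x ^ 10)⁻¹ + secondMomentUpper / (2 * p) + p ^ 2 * Real.exp (-(x / 2))) / meanSLower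

theorem measureReal_error_le {p : ℕ} (hp : 1024 ≤ p) {x : ℝ} (hx : 0 < x) :
    (signalLaw p).real {θ | ¬ matrixSpectralNorm
        (networkMatrix (thirdMoment θ) (tensorPow 5 θ) -
          (targetMatrix θ).map (fun x : ℝ => (x : ℂ))) ≤
        √((fluctuation p x * x ^ 2) ^ 2 + 2 * (x ^ 4 / p))} ≤
      p * (2 * Real.exp (-(x / 2))) +
        (p : ℝ) ^ 4 * (2 * Real.exp (-(p / (1568 * x ^ 48)))) := by
  have hp0 : 0 < p := by omega
  have hp' : (0 : ℝ) < p := by exact_mod_cast hp0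
  set R : ℝ := x / p with hR
  have hR0 : 0 ≤ R := by positivity
  -- Relative to the mean this is of order `x ^ (-10)`: small enough to absorb the factor `x ^ 2` in
  -- the final error, large enough for a McDiarmid exponent of `p / (1568 * x ^ 48)`, where `1568 =
  -- 2 * 28 ^ 2`.
  set t : ℝ := ((p : ℝ) ^ 9)⁻¹ * (x ^ 10)⁻¹ with ht
  have ht0 : 0 ≤ t := by positivity
  set B1 : Set (Freq p → ℝ) := {θ | ∃ k, R < θ k ^ 2} with hB1
  set B2 : Freq p × Freq p × Freq p × Freq p → Set (Freq p → ℝ) := fun q =>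
    {θ | t ≤ |sCoeff (clip R θ) q.1 q.2.1 q.2.2.1 q.2.2.2 -
      ∫ φ, sCoeff (clip R φ) q.1 q.2.1 q.2.2.1 q.2.2.2 ∂(signalLaw p)|} with hB2
  have hP1 : (signalLaw p).real B1 ≤ p * (2 * Real.exp (-(x / 2))) :=
    measureReal_exists_coord_sq_gt_le hp0 hx.le
  have hexp : -t ^ 2 / (2 * (p * (28 * (p : ℝ) ^ 4 * R ^ 14) ^ 2)) = -(p / (1568 * x ^ 48)) := by
    rw [ht, hR]
    field_simp
    ring
  have hP2 : (signalLaw p).real (⋃ q, B2 q) ≤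
      (p : ℝ) ^ 4 * (2 * Real.exp (-(p / (1568 * x ^ 48)))) := by
    calc _ ≤ ∑ q, (signalLaw p).real (B2 q) := measureReal_iUnion_fintype_le _
      _ ≤ ∑ _q : Freq p × Freq p × Freq p × Freq p,
            2 * Real.exp (-(p / (1568 * x ^ 48))) := Finset.sum_le_sum fun q _ => by
          rw [← hexp]
          exact measureReal_abs_sCoeff_clip_sub_ge_le hR0 _ _ _ _ ht0
      _ = (Fintype.card (Freq p) : ℝ) ^ 4 * (2 * Real.exp (-(p / (1568 * x ^ 48)))) := by
          rw [Finset.sum_const, Finset.card_univ, nsmul_eq_mul]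
          simp only [Fintype.card_prod]
          push_cast
          ring
      _ ≤ _ := by
          gcongr
          exact card_freq_le p
  have hlow : ∀ a b c d : Freq p, meanSLower * ((p : ℝ) ^ 9)⁻¹ ≤ meanS a b c d := le_meanS hp
  have hpos : ∀ a b c d : Freq p, 0 < meanS a b c d := fun a b c d =>
    (mul_pos meanSLower_pos (by positivity)).trans_le (hlow a b c d)
  have hgap : ∀ a b c d : Freq p, t + (meanS a b c d -
      ∫ θ, sCoeff (clip R θ) a b c d ∂(signalLaw p)) ≤ fluctuation p x * meanS a b c d := by
    intro a b c d
    -- With `δ = p ^ 8` the second-moment term is of order `p ^ (-10)`, a factor `p` below the mean,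
    -- while the other term still carries the exponential tail.
    have h1 := meanS_sub_integral_sCoeff_clip_le hp0 (R := R) (δ := (p : ℝ) ^ 8) (by positivity) a b c d
    have hM : (0 : ℝ) ≤ secondMomentUpper :=
      mul_nonneg (by norm_num) (integral_even_pow_nonneg 28)
    have hf : 0 ≤ fluctuation p x :=
      div_nonneg (by positivity) meanSLower_pos.le
    have hL := meanSLower_pos.ne'
    calc _ ≤ t + ((p : ℝ) ^ 8 * (secondMomentUpper * ((p : ℝ) ^ 18)⁻¹) +
          ((p : ℝ) ^ 8)⁻¹ * (p * (2 * Real.exp (-(x / 2))))) / 2 := by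
          refine add_le_add le_rfl (h1.trans ?_)
          gcongr
          exact le_rfl
      _ = fluctuation p x * (meanSLower * ((p : ℝ) ^ 9)⁻¹) := by
          rw [ht, fluctuation]
          field_simp
          ring
      _ ≤ _ := mul_le_mul_of_nonneg_left (hlow a b c d) hf
  calc _ ≤ (signalLaw p).real (B1 ∪ ⋃ q, B2 q) := by
        refine measureReal_mono fun θ hθ => ?_
        by_contra hθB
        rw [Set.mem_union, not_or] at hθB
        have hθ1 : ∀ k, θ k ^ 2 ≤ R := fun k => not_lt.1 fun h => hθB.1 ⟨k, h⟩
        refine hθ ((matrixSpectralNorm_networkMatrix_sub_le θ).trans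
          (sqrt_error_le hp0 hx.le hθ1 hpos fun a b c d => ?_))
        have hθ2 : |sCoeff (clip R θ) a b c d -
            ∫ φ, sCoeff (clip R φ) a b c d ∂(signalLaw p)| < t :=
          not_le.1 fun h => hθB.2 (Set.mem_iUnion.2 ⟨(a, b, c, d), h⟩)
        rw [clip_eq_self hθ1] at hθ2
        refine le_trans ?_ (hgap a b c d)
        have h3 := integral_sCoeff_clip_le_meanS R a b c d
        rw [abs_lt] at hθ2
        rw [abs_le]
        constructor <;> linarith [hθ2.1, hθ2.2]
    _ ≤ _ := measureReal_union_le _ _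
    _ ≤ _ := add_le_add hP1 hP2

/-! ### Asymptotics -/

theorem tendsto_pow_mul_exp_neg_half (n : ℕ) :
    Tendsto (fun x : ℝ => x ^ n * Real.exp (-(x / 2))) atTop (𝓝 0) := by
  have h := ((Real.tendsto_pow_mul_exp_neg_atTop_nhds_zero n).comp
    (tendsto_id.atTop_div_const (two_pos : (0 : ℝ) < 2))).const_mul (2 ^ n)
  rw [mul_zero] at h
  refine h.congr fun x => ?_
  simp only [Function.comp_apply, id, div_pow]
  field_simp

/-- The truncation parameter `p ^ (1 / 100)`. -/
def truncationLevel (p : ℕ) : ℝ := (p : ℝ) ^ ((100 : ℕ) : ℝ)⁻¹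

theorem truncationLevel_pow (p : ℕ) : truncationLevel p ^ 100 = p :=
  Real.rpow_inv_natCast_pow p.cast_nonneg (by norm_num)

theorem tendsto_truncationLevel : Tendsto truncationLevel atTop atTop :=
  (tendsto_rpow_atTop (by norm_num)).comp tendsto_natCast_atTop_atTop

/-- The error bound for the corrected network matrix. -/
def errorBound (p : ℕ) : ℝ :=
  √((fluctuation p (truncationLevel p) * truncationLevel p ^ 2) ^ 2 +
    2 * (truncationLevel p ^ 4 / p))

theorem tendsto_errorBound : Tendsto errorBound atTop (𝓝 0) := by
  have hinv : ∀ n : ℕ, n ≠ 0 → Tendsto (fun x : ℝ => (x ^ n)⁻¹) atTop (𝓝 0) := fun n hn =>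
    (tendsto_pow_atTop hn).inv_tendsto_atTop
  have h1 : Tendsto (fun x : ℝ => ((x ^ 8)⁻¹ + secondMomentUpper / 2 * (x ^ 98)⁻¹ +
      x ^ 202 * Real.exp (-(x / 2))) / meanSLower) atTop (𝓝 0) := by
    have := (((hinv 8 (by norm_num)).add ((hinv 98 (by norm_num)).const_mul
      (secondMomentUpper / 2))).add (tendsto_pow_mul_exp_neg_half 202)).div_const meanSLower
    simpa using this
  have h2 := ((h1.pow 2).add ((hinv 96 (by norm_num)).const_mul 2)).sqrt
  norm_num at h2
  refine (h2.comp tendsto_truncationLevel).congr' ?_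
  filter_upwards [tendsto_truncationLevel.eventually_gt_atTop 0] with p hp
  rw [Function.comp_apply, errorBound, ← truncationLevel_pow p, fluctuation]
  generalize truncationLevel p = x at hp
  have hL := meanSLower_pos.ne'
  congr 2
  · congr 1
    field_simp
  · field_simp

/-- The bound for the probability that the error exceeds `errorBound`, for large `p`. -/
def failureBound (p : ℕ) : ℝ := 2 * (p + (p : ℝ) ^ 4) * Real.exp (-(truncationLevel p / 2))

theorem superpolynomialDecay_failureBound :
    Asymptotics.SuperpolynomialDecay atTop (fun p : ℕ => (p : ℝ)) failureBound := by
  intro n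
  have h := (((tendsto_pow_mul_exp_neg_half (100 * n + 100)).add
    (tendsto_pow_mul_exp_neg_half (100 * n + 400))).const_mul 2).comp tendsto_truncationLevel
  norm_num at h
  refine h.congr fun p => ?_
  simp only [Function.comp_apply, failureBound]
  rw [← truncationLevel_pow p]
  ring

theorem measureReal_errorBound_le {p : ℕ} (hp : 1024 ≤ p) (hx : 2 ≤ truncationLevel p) :
    (signalLaw p).real {θ | ¬ matrixSpectralNorm
        (networkMatrix (thirdMoment θ) (tensorPow 5 θ) -
          (targetMatrix θ).map (fun x : ℝ => (x : ℂ))) ≤ errorBound p} ≤ failureBound p := by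
  refine (measureReal_error_le hp (by linarith : 0 < truncationLevel p)).trans ?_
  have h : truncationLevel p / 2 ≤ p / (1568 * truncationLevel p ^ 48) := by
    rw [← truncationLevel_pow p]
    generalize truncationLevel p = x at hx
    have hx0 : 0 < x := by linarith
    rw [div_le_div_iff₀ (by norm_num) (by positivity)]
    have h1 : (2 : ℝ) ^ 51 ≤ x ^ 51 := pow_le_pow_left₀ (by norm_num) hx 51
    have h2 : x ^ 49 * 1568 ≤ x ^ 49 * (x ^ 51 * 2) := by
      gcongr
      linarith [show (1568 : ℝ) ≤ 2 ^ 51 by norm_num]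
    linear_combination h2
  have h2 : Real.exp (-(p / (1568 * truncationLevel p ^ 48))) ≤
      Real.exp (-(truncationLevel p / 2)) :=
    Real.exp_le_exp.2 (neg_le_neg h)
  rw [failureBound]
  have h3 := mul_le_mul_of_nonneg_left h2 (by positivity : (0 : ℝ) ≤ 2 * (p : ℝ) ^ 4)
  linarith

end ContinuousMRA

end

theorem mainTheorem4 :
    (∃ c₁ c₂ : ℝ, 0 < c₁ ∧ 0 < c₂ ∧
      ∀ᶠ p : ℕ in atTop, Even p → ∀ a b c d : Freq p,
        c₁ * ((p : ℝ) ^ 9)⁻¹ ≤ meanS a b c d ∧ meanS a b c d ≤ c₂ * ((p : ℝ) ^ 9)⁻¹) ∧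
    (∃ η fail : ℕ → ℝ,
      Tendsto η atTop (𝓝 0) ∧
      Asymptotics.SuperpolynomialDecay atTop (fun p : ℕ => (p : ℝ)) fail ∧
      ∀ p : ℕ, Even p → ∀ (K : ℕ) (k : Fin K),
        (Measure.pi fun _ : Fin K => signalLaw p).real
          {θ : Fin K → Freq p → ℝ |
            ¬ matrixSpectralNorm
                (networkMatrix (thirdMoment (θ k)) (tensorPow 5 (θ k)) -
                  (targetMatrix (θ k)).map (fun x : ℝ => (x : ℂ))) ≤ η p} ≤ fail p) := by
  refine ⟨⟨meanSLower, 28 * (∫ x, x ^ (2 * 14) ∂(gaussianReal 0 1)) + 1, meanSLower_pos, ?_, ?_⟩,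
    ?_⟩
  · linarith [integral_even_pow_nonneg 14]
  · filter_upwards [eventually_ge_atTop 1024] with p hp _ a b c d
    refine ⟨le_meanS hp a b c d, (meanS_le (by omega) a b c d).trans ?_⟩
    gcongr
    linarith
  · have hev : ∀ᶠ p : ℕ in atTop, 1024 ≤ p ∧ 2 ≤ truncationLevel p :=
      (eventually_ge_atTop 1024).and (tendsto_truncationLevel.eventually_ge_atTop 2)
    classical
    refine ⟨errorBound, fun p => if 1024 ≤ p ∧ 2 ≤ truncationLevel p then failureBound p else 1,
      tendsto_errorBound, superpolynomialDecay_failureBound.congr' ?_, fun p _ K k => ?_⟩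
    · filter_upwards [hev] with p hp
      rw [if_pos hp]
    · beta_reduce
      split_ifs with hp
      · refine le_trans ?_ (measureReal_errorBound_le hp.1 hp.2)
        have hmp := measurePreserving_eval (fun _ : Fin K => signalLaw p) k
        refine ENNReal.toReal_mono (measure_ne_top _ _) ?_
        have := Measure.le_map_apply (μ := Measure.pi fun _ : Fin K => signalLaw p)
          hmp.measurable.aemeasurable {θ | ¬ matrixSpectralNorm
          (networkMatrix (thirdMoment θ) (tensorPow 5 θ) -
            (targetMatrix θ).map (fun x : ℝ => (x : ℂ))) ≤ errorBound p}
        rw [hmp.map_eq] at this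
        exact this
      · exact measureReal_le_one
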